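/- For $u \in \mathscr{S}'(\mathbf{R}^n)$ and $\varphi \in \mathscr{S}(\mathbf{R}^n)$ let $(u,\varphi)$ denote the action of $u$ on $\varphi$, conjugate linear in $\varphi$ and consistent with the $L^2$ inner product. For $\sigma \in \mathscr{S}'(\mathbf{R}^{2n})$ the Weyl operator $\sigma^w(x,D) : \mathscr{S}(\mathbf{R}^n) \to \mathscr{S}'(\mathbf{R}^n)$ is defined by $$(\sigma^w(x,D) f, g) = (2\pi)^{-\frac n2} (\sigma, W(g,f)), \qquad W(g,f)(x,\xi) = (2\pi)^{-\frac n2} \int_{\mathbf{R}^n} g(x+y/2)\, \overline{f(x-y/2)}\, e^{-i\langle y,\xi\rangle}\, \mathrm{d}y, \qquad f,g \in \mathscr{S}(\mathbf{R}^n),$$ and $\sigma^w(x,D) \geqslant 0$ on $\mathscr{S}(\mathbf{R}^n)$ means that $(\sigma^w(x,D) f, f) \geqslant 0$ for all $f \in \mathscr{S}(\mathbf{R}^n)$. **Proposition.** Suppose $a \in \mathscr{S}'(\mathbf{R}^{2d})$ and $a^w(x,D) \geqslant 0$ on $\mathscr{S}(\mathbf{R}^d)$. If $$b(x_1,x_2,\xi_1,\xi_2)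 = a\left(x_1 - \tfrac12 \xi_2,\, x_2 + \tfrac12 \xi_1\right) a\left(x_1 + \tfrac12 \xi_2,\, x_2 - \tfrac12 \xi_1\right) \in \mathscr{S}'(\mathbf{R}^{4d}), \qquad x_1,x_2,\xi_1,\xi_2 \in \mathbf{R}^d,$$ that is, $b$ is the composition of the tensor product $a \otimes a \in \mathscr{S}'(\mathbf{R}^{4d})$ with the linear isomorphism $(x_1,x_2,\xi_1,\xi_2) \mapsto (x_1 - \tfrac12 \xi_2, x_2 + \tfrac12 \xi_1, x_1 + \tfrac12 \xi_2, x_2 - \tfrac12 \xi_1)$, then $b^w(x,D) \geqslant 0$ on $\mathscr{S}(\mathbf{R}^{2d})$. -/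

import Mathlib

open MeasureTheory
open scoped SchwartzMap ContDiff LineDeriv

noncomputable section

namespace WeylCalculus

section Construction

variable {D E F : Type*} [NormedAddCommGroup D] [NormedSpace ℝ D]
  [NormedAddCommGroup E] [NormedSpace ℝ E] [NormedAddCommGroup F] [NormedSpace ℝ F]

theorem seminorm_bound {q : Seminorm ℂ 𝓢(D, ℂ)} (hq : Continuous q) :
    ∃ (s : Finset (ℕ × ℕ)) (C : ℝ), 0 ≤ C ∧ ∀ f : 𝓢(D, ℂ),
      q f ≤ C * s.sup (schwartzSeminormFamily ℂ D ℂ) f := by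
  obtain ⟨s, C, -, h⟩ := Seminorm.bound_of_continuous (schwartz_withSeminorms ℂ D ℂ) q hq
  exact ⟨s, C, C.2, fun f => h f⟩

theorem seminorm_sum_apply {ι : Type*} (s : Finset ι) (p : ι → Seminorm ℂ 𝓢(D, ℂ))
    (f : 𝓢(D, ℂ)) : (∑ i ∈ s, p i) f = ∑ i ∈ s, p i f := by
  classical
  induction s using Finset.induction_on with
  | empty => simp
  | insert a s ha ih => rw [Finset.sum_insert ha, Finset.sum_insert ha, ← ih]; rfl

theorem fderiv_eq_sum [FiniteDimensional ℝ E] (L : E →L[ℝ] ℂ) :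
    L = ∑ i, ContinuousLinearMap.smulRightL ℝ E ℂ
      (LinearMap.toContinuousLinearMap ((Module.finBasis ℝ E).coord i))
        (L (Module.finBasis ℝ E i)) := by
  ext m
  conv_lhs => rw [← (Module.finBasis ℝ E).sum_repr m]
  simp only [map_sum, map_smul]
  simp

variable [FiniteDimensional ℝ E]

section

variable {A : 𝓢(D, ℂ) → E → ℂ} {δ : E → 𝓢(D, ℂ) →L[ℂ] 𝓢(D, ℂ)}

theorem param_fderiv
    (hderiv : ∀ f x, ∃ L : E →L[ℝ] ℂ, HasFDerivAt (A f) L x ∧ ∀ m, L m = A (δ m f) x)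
    (f : 𝓢(D, ℂ)) : fderiv ℝ (A f) = fun x => ∑ i,
    ContinuousLinearMap.smulRightL ℝ E ℂ
      (LinearMap.toContinuousLinearMap ((Module.finBasis ℝ E).coord i))
        (A (δ (Module.finBasis ℝ E i) f) x) := by
  funext x
  obtain ⟨L, hL, hm⟩ := hderiv f x
  rw [hL.fderiv, fderiv_eq_sum L]
  simp only [← hm]

theorem param_contDiff_nat
    (hderiv : ∀ f x, ∃ L : E →L[ℝ] ℂ, HasFDerivAt (A f) L x ∧ ∀ m, L m = A (δ m f) x)
    (n : ℕ) : ∀ f : 𝓢(D, ℂ), ContDiff ℝ n (A f) := by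
  induction n with
  | zero =>
    intro f
    refine contDiff_zero.2 (continuous_iff_continuousAt.2 fun x => ?_)
    obtain ⟨L, hL, -⟩ := hderiv f x
    exact hL.continuousAt
  | succ n ih =>
    intro f
    push_cast
    refine contDiff_succ_iff_fderiv.2 ⟨fun x => ?_, by simp, ?_⟩
    · obtain ⟨L, hL, -⟩ := hderiv f x
      exact hL.differentiableAt
    · rw [param_fderiv hderiv f]
      exact ContDiff.sum fun i _ => (ContinuousLinearMap.contDiff _).comp (ih _)

theorem param_bound
    (hderiv : ∀ f x, ∃ L : E →L[ℝ] ℂ, HasFDerivAt (A f) L x ∧ ∀ m, L m = A (δ m f) x)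
    (hdecay : ∀ k : ℕ, ∃ q : Seminorm ℂ 𝓢(D, ℂ), Continuous q ∧
      ∀ f x, ‖x‖ ^ k * ‖A f x‖ ≤ q f) (k n : ℕ) :
    ∃ q : Seminorm ℂ 𝓢(D, ℂ), Continuous q ∧
      ∀ f x, ‖x‖ ^ k * ‖iteratedFDeriv ℝ n (A f) x‖ ≤ q f := by
  induction n with
  | zero => simpa using hdecay k
  | succ n ih =>
    obtain ⟨q, hq, h⟩ := ih
    let T : Fin (Module.finrank ℝ E) → ℂ →L[ℝ] E →L[ℝ] ℂ := fun i =>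
      ContinuousLinearMap.smulRightL ℝ E ℂ
        (LinearMap.toContinuousLinearMap ((Module.finBasis ℝ E).coord i))
    let q' : Seminorm ℂ 𝓢(D, ℂ) :=
      ∑ i, (‖T i‖₊ • q.comp (δ (Module.finBasis ℝ E i)).toLinearMap)
    have hq' (f : 𝓢(D, ℂ)) : q' f = ∑ i, ‖T i‖ * q (δ (Module.finBasis ℝ E i) f) := by
      rw [seminorm_sum_apply]
      rfl
    refine ⟨q', ?_, fun f x => ?_⟩
    · have : (q' : 𝓢(D, ℂ) → ℝ) = fun f => ∑ i, ‖T i‖ * q (δ (Module.finBasis ℝ E i) f) :=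
        funext hq'
      rw [this]
      exact continuous_finsetSum _ fun i _ =>
        continuous_const.mul (hq.comp (δ _).continuous)
    · rw [hq', ← norm_iteratedFDeriv_fderiv, param_fderiv hderiv f,
        iteratedFDeriv_fun_sum_apply (f := fun i y => T i (A (δ (Module.finBasis ℝ E i) f) y))
          (fun i _ => ((ContinuousLinearMap.contDiff (T i)).comp
            (param_contDiff_nat hderiv n _)).contDiffAt)]
      calc
        _ ≤ ‖x‖ ^ k * ∑ i, ‖iteratedFDeriv ℝ n
              (fun y => T i (A (δ (Module.finBasis ℝ E i) f) y)) x‖ := by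
          gcongr
          exact norm_sum_le _ _
        _ ≤ ‖x‖ ^ k * ∑ i, ‖T i‖ * ‖iteratedFDeriv ℝ n
              (A (δ (Module.finBasis ℝ E i) f)) x‖ := by
          gcongr with i _
          exact (T i).norm_iteratedFDeriv_comp_left
            (param_contDiff_nat hderiv n _).contDiffAt le_rfl
        _ = ∑ i, ‖T i‖ * (‖x‖ ^ k * ‖iteratedFDeriv ℝ n
              (A (δ (Module.finBasis ℝ E i) f)) x‖) := by
          rw [Finset.mul_sum]
          exact Finset.sum_congr rfl fun i _ => by ring
        _ ≤ _ := by
          gcongr with i _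
          exact h _ _

end

/-- A linear family `A f : E → ℂ`, `f ∈ 𝓢(D)`, whose derivatives are again of the form `A (δ f)`
and which decays rapidly, defines a continuous linear map `𝓢(D) → 𝓢(E)`. -/
def paramCLM (A : 𝓢(D, ℂ) → E → ℂ) (δ : E → 𝓢(D, ℂ) →L[ℂ] 𝓢(D, ℂ))
    (hadd : ∀ f g x, A (f + g) x = A f x + A g x)
    (hsmul : ∀ (c : ℂ) f x, A (c • f) x = c • A f x)
    (hderiv : ∀ f x, ∃ L : E →L[ℝ] ℂ, HasFDerivAt (A f) L x ∧ ∀ m, L m = A (δ m f) x)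
    (hdecay : ∀ k : ℕ, ∃ q : Seminorm ℂ 𝓢(D, ℂ), Continuous q ∧
      ∀ f x, ‖x‖ ^ k * ‖A f x‖ ≤ q f) : 𝓢(D, ℂ) →L[ℂ] 𝓢(E, ℂ) :=
  SchwartzMap.mkCLM A hadd hsmul
    (fun f => contDiff_infty.2 fun n => param_contDiff_nat hderiv n f)
    (fun n => by
      obtain ⟨q, hq, h⟩ := param_bound hderiv hdecay n.1 n.2
      obtain ⟨s, C, hC, hs⟩ := seminorm_bound hq
      exact ⟨s, C, hC, fun f x => (h f x).trans (hs f)⟩)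


end Construction

section Slice

variable {E F : Type*} [NormedAddCommGroup E] [NormedSpace ℝ E]
  [NormedAddCommGroup F] [NormedSpace ℝ F]

theorem hasTemperateGrowth_mk (x : E) : (fun y : F => (x, y)).HasTemperateGrowth := by
  have : (fun y : F => (x, y)) = fun y => (x, (0 : F)) + ContinuousLinearMap.inr ℝ E F y := by
    funext y; simp
  rw [this]
  fun_prop

/-- The slice `y ↦ Φ (x, y)`. -/
def slice (x : E) : 𝓢(E × F, ℂ) →L[ℂ] 𝓢(F, ℂ) :=
  SchwartzMap.compCLMOfAntilipschitz ℂ (hasTemperateGrowth_mk x) (K := 1)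
    (AntilipschitzWith.of_le_mul_dist fun y z => by simp [Prod.dist_eq])

@[simp] theorem slice_apply (x : E) (Φ : 𝓢(E × F, ℂ)) (y : F) : slice x Φ y = Φ (x, y) := rfl

theorem iteratedFDeriv_slice (x : E) (Φ : 𝓢(E × F, ℂ)) (n : ℕ) (y : F) :
    iteratedFDeriv ℝ n (slice x Φ) y = (iteratedFDeriv ℝ n Φ (x, y)).compContinuousLinearMap
      (fun _ => ContinuousLinearMap.inr ℝ E F) := by
  have : (slice x Φ : F → ℂ) =
      (fun p => Φ (p + (x, 0))) ∘ ContinuousLinearMap.inr ℝ E F := by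
    funext y; simp
  have hc : ContDiff ℝ n (fun p : E × F => Φ (p + (x, 0))) :=
    (Φ.smooth n).comp (contDiff_id.add contDiff_const)
  rw [this, ContinuousLinearMap.iteratedFDeriv_comp_right _ hc y le_rfl]
  rw [iteratedFDeriv_comp_add_right]
  simp

theorem norm_iteratedFDeriv_slice_le (x : E) (Φ : 𝓢(E × F, ℂ)) (n : ℕ) (y : F) :
    ‖iteratedFDeriv ℝ n (slice x Φ) y‖ ≤ ‖iteratedFDeriv ℝ n Φ (x, y)‖ := by
  rw [iteratedFDeriv_slice]
  refine (ContinuousMultilinearMap.norm_compContinuousLinearMap_le _ _).trans ?_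
  refine mul_le_of_le_one_right (norm_nonneg _) (Finset.prod_le_one (by simp) fun _ _ => ?_)
  exact ContinuousLinearMap.norm_inr_le_one ℝ E F

theorem pow_mul_seminorm_slice_le (j k n : ℕ) (x : E) (Φ : 𝓢(E × F, ℂ)) :
    ‖x‖ ^ j * SchwartzMap.seminorm ℂ k n (slice x Φ) ≤ SchwartzMap.seminorm ℂ (j + k) n Φ := by
  rcases eq_or_lt_of_le (pow_nonneg (norm_nonneg x) j) with h0 | h0
  · rw [← h0, zero_mul]
    exact apply_nonneg _ _
  rw [← le_div_iff₀' h0]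
  refine SchwartzMap.seminorm_le_bound ℂ k n _ (by positivity) fun y => ?_
  rw [le_div_iff₀' h0]
  calc
    _ ≤ ‖(x, y)‖ ^ j * (‖(x, y)‖ ^ k * ‖iteratedFDeriv ℝ n Φ (x, y)‖) := by
      gcongr
      · exact norm_fst_le (x, y)
      · exact norm_snd_le (x, y)
      · exact norm_iteratedFDeriv_slice_le x Φ n y
    _ = ‖(x, y)‖ ^ (j + k) * ‖iteratedFDeriv ℝ n Φ (x, y)‖ := by ring
    _ ≤ _ := SchwartzMap.le_seminorm ℂ _ _ _ _

theorem slice_decay {q : Seminorm ℂ 𝓢(F, ℂ)} (hq : Continuous q) (j : ℕ) :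
    ∃ q' : Seminorm ℂ 𝓢(E × F, ℂ), Continuous q' ∧
      ∀ Φ (x : E), ‖x‖ ^ j * q (slice x Φ) ≤ q' Φ := by
  obtain ⟨s, C, hC, h⟩ := seminorm_bound hq
  let q' : Seminorm ℂ 𝓢(E × F, ℂ) :=
    ∑ i ∈ s, C.toNNReal • SchwartzMap.seminorm ℂ (j + i.1) i.2
  have hq' (Φ) : q' Φ = ∑ i ∈ s, C * SchwartzMap.seminorm ℂ (j + i.1) i.2 Φ := by
    rw [seminorm_sum_apply]
    refine Finset.sum_congr rfl fun i _ => ?_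
    change (C.toNNReal : ℝ) * _ = _
    rw [Real.coe_toNNReal _ hC]
  refine ⟨q', ?_, fun Φ x => ?_⟩
  · rw [show (q' : 𝓢(E × F, ℂ) → ℝ) = _ from funext hq']
    exact continuous_finsetSum _ fun i _ => continuous_const.mul
      ((schwartz_withSeminorms ℂ (E × F) ℂ).continuous_seminorm (j + i.1, i.2))
  · rw [hq']
    calc
      _ ≤ ‖x‖ ^ j * (C * ∑ i ∈ s, SchwartzMap.seminorm ℂ i.1 i.2 (slice x Φ)) := by
        gcongr
        refine (h _).trans ?_
        gcongr
        have := Seminorm.finset_sup_le_sum (schwartzSeminormFamily ℂ F ℂ) s (slice x Φ)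
        rwa [seminorm_sum_apply] at this
      _ = ∑ i ∈ s, C * (‖x‖ ^ j * SchwartzMap.seminorm ℂ i.1 i.2 (slice x Φ)) := by
        rw [Finset.mul_sum, Finset.mul_sum]
        exact Finset.sum_congr rfl fun i _ => by ring
      _ ≤ _ := by
        gcongr with i _
        exact pow_mul_seminorm_slice_le _ _ _ _ _

theorem lineDeriv_comm (v w : E) (Φ : 𝓢(E, ℂ)) : ∂_{v} (∂_{w} Φ) = ∂_{w} (∂_{v} Φ) := by
  have key (a b : E) (x : E) : (∂_{a} (∂_{b} Φ) : 𝓢(E, ℂ)) x = fderiv ℝ (fderiv ℝ Φ) x a b := by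
    rw [SchwartzMap.lineDerivOp_apply_eq_fderiv]
    have : ((∂_{b} Φ : 𝓢(E, ℂ)) : E → ℂ) = fun y => fderiv ℝ Φ y b :=
      funext fun y => SchwartzMap.lineDerivOp_apply_eq_fderiv b Φ y
    rw [this, fderiv_clm_apply _ (by fun_prop)]
    · simp
    · exact ((Φ.smooth 2).fderiv_right (m := 1) (by norm_num)).differentiable (by norm_num) x
  ext x
  rw [key, key]
  exact ((Φ.smooth 2).contDiffAt.isSymmSndFDerivAt (by simp)).eq v w

theorem iteratedLineDeriv_comm {n : ℕ} (m : Fin n → E) (w : E) (Φ : 𝓢(E, ℂ)) :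
    ∂^{m} (∂_{w} Φ) = ∂_{w} (∂^{m} Φ) := by
  induction n with
  | zero => simp
  | succ n ih => rw [LineDeriv.iteratedLineDerivOp_succ_left, LineDeriv.iteratedLineDerivOp_succ_left, ih,
      lineDeriv_comm]

theorem iteratedFDeriv_lineDeriv (n : ℕ) (w : E) (Φ : 𝓢(E, ℂ)) (p : E) :
    iteratedFDeriv ℝ n (∂_{w} Φ : 𝓢(E, ℂ)) p = fderiv ℝ (iteratedFDeriv ℝ n Φ) p w := by
  refine ContinuousMultilinearMap.ext fun m => ?_
  rw [← SchwartzMap.iteratedLineDerivOp_eq_iteratedFDeriv, iteratedLineDeriv_comm,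
    SchwartzMap.lineDerivOp_apply_eq_fderiv,
    ← fderiv_continuousMultilinear_apply_const_apply]
  · congr 2
    exact funext fun y => SchwartzMap.iteratedLineDerivOp_eq_iteratedFDeriv
  · exact (Φ.smooth ⊤).differentiable_iteratedFDeriv (mod_cast ENat.natCast_lt_top n) p

theorem taylor_bound (n : ℕ) (Φ : 𝓢(E, ℂ)) (p w : E) (M : ℝ)
    (hM : ∀ z ∈ segment ℝ p (p + w), ‖iteratedFDeriv ℝ (n + 2) Φ z‖ ≤ M) :
    ‖iteratedFDeriv ℝ n Φ (p + w) - iteratedFDeriv ℝ n Φ p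
      - fderiv ℝ (iteratedFDeriv ℝ n Φ) p w‖ ≤ M * ‖w‖ ^ 2 := by
  have hd (l : ℕ) : Differentiable ℝ (iteratedFDeriv ℝ l Φ) :=
    (Φ.smooth ⊤).differentiable_iteratedFDeriv (mod_cast ENat.natCast_lt_top l)
  have hM0 : 0 ≤ M := (norm_nonneg _).trans (hM p (left_mem_segment ℝ _ _))
  have h1 : ∀ z ∈ segment ℝ p (p + w),
      ‖fderiv ℝ (iteratedFDeriv ℝ n Φ) z - fderiv ℝ (iteratedFDeriv ℝ n Φ) p‖ ≤ M * ‖w‖ := by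
    intro z hz
    rw [fderiv_iteratedFDeriv]
    simp only [Function.comp_apply]
    have e := (continuousMultilinearCurryLeftEquiv ℝ (fun _ : Fin (n + 1) => E) ℂ).dist_map
      (iteratedFDeriv ℝ (n + 1) Φ z) (iteratedFDeriv ℝ (n + 1) Φ p)
    rw [dist_eq_norm, dist_eq_norm] at e
    refine e.le.trans (((convex_segment p (p + w)).norm_image_sub_le_of_norm_fderiv_le
      (fun x _ => hd (n + 1) x) (C := M) (fun x hx => ?_) (left_mem_segment ℝ _ _) hz).trans ?_)
    · rw [norm_fderiv_iteratedFDeriv]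
      exact hM x hx
    · gcongr
      obtain ⟨t, ht, rfl⟩ := (segment_eq_image' ℝ p (p + w)) ▸ hz
      simp only [add_sub_cancel_left, norm_smul, Real.norm_eq_abs, abs_of_nonneg ht.1]
      exact mul_le_of_le_one_left (norm_nonneg _) ht.2
  have := (convex_segment p (p + w)).norm_image_sub_le_of_norm_fderiv_le'
    (fun x _ => hd n x) h1 (left_mem_segment ℝ _ _) (right_mem_segment ℝ _ _)
  rw [add_sub_cancel_left] at this
  exact this.trans_eq (by ring)

theorem seminorm_slice_remainder (k n : ℕ) (Φ : 𝓢(E × F, ℂ)) (x h : E) :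
    SchwartzMap.seminorm ℂ k n (slice (x + h) Φ - slice x Φ - slice x (∂_{(h, (0 : F))} Φ)) ≤
      SchwartzMap.seminorm ℂ k (n + 2) Φ * ‖h‖ ^ 2 := by
  refine SchwartzMap.seminorm_le_bound ℂ k n _ (by positivity) fun y => ?_
  have hn : ‖((h, (0 : F)) : E × F)‖ = ‖h‖ := by simp [Prod.norm_def]
  have hs (f g : 𝓢(F, ℂ)) : iteratedFDeriv ℝ n (f - g : 𝓢(F, ℂ)) y =
      iteratedFDeriv ℝ n f y - iteratedFDeriv ℝ n g y := by
    rw [show ((f - g : 𝓢(F, ℂ)) : F → ℂ) = (f : F → ℂ) - (g : F → ℂ) from rfl]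
    exact iteratedFDeriv_sub_apply (f.smooth n).contDiffAt (g.smooth n).contDiffAt
  rcases eq_or_lt_of_le (pow_nonneg (norm_nonneg y) k) with h0 | h0
  · rw [← h0, zero_mul]
    positivity
  have ht := taylor_bound n Φ (x, y) (h, (0 : F))
    (SchwartzMap.seminorm ℂ k (n + 2) Φ / ‖y‖ ^ k) (fun z hz => by
      rw [le_div_iff₀' h0]
      have hz2 : z.2 = y := by
        obtain ⟨t, ht, rfl⟩ := (segment_eq_image' ℝ (x, y) ((x, y) + (h, (0 : F)))) ▸ hz
        simp
      refine le_trans ?_ (SchwartzMap.le_seminorm ℂ k (n + 2) Φ z)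
      gcongr
      rw [← hz2]
      exact norm_snd_le z)
  rw [hn] at ht
  rw [hs, hs, iteratedFDeriv_slice, iteratedFDeriv_slice, iteratedFDeriv_slice,
    iteratedFDeriv_lineDeriv]
  have hp : ((x + h, y) : E × F) = (x, y) + (h, 0) := by simp
  rw [hp]
  set T := iteratedFDeriv ℝ n Φ ((x, y) + (h, 0)) - iteratedFDeriv ℝ n Φ (x, y)
      - fderiv ℝ (iteratedFDeriv ℝ n Φ) (x, y) (h, 0) with hT
  have hle : ‖T.compContinuousLinearMap (fun _ => ContinuousLinearMap.inr ℝ E F)‖ ≤ ‖T‖ := by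
    refine (ContinuousMultilinearMap.norm_compContinuousLinearMap_le _ _).trans ?_
    refine mul_le_of_le_one_right (norm_nonneg _) (Finset.prod_le_one (by simp) fun _ _ => ?_)
    exact ContinuousLinearMap.norm_inr_le_one ℝ E F
  calc
    _ = ‖y‖ ^ k * ‖T.compContinuousLinearMap (fun _ => ContinuousLinearMap.inr ℝ E F)‖ := rfl
    _ ≤ ‖y‖ ^ k * (SchwartzMap.seminorm ℂ k (n + 2) Φ / ‖y‖ ^ k * ‖h‖ ^ 2) := by
      gcongr
      exact hle.trans ht
    _ = _ := by field_simp

end Slice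

section DistributionTensor

variable {E F : Type*} [NormedAddCommGroup E] [NormedSpace ℝ E] [FiniteDimensional ℝ E]
  [NormedAddCommGroup F] [NormedSpace ℝ F]

theorem hasFDerivAt_apply_slice (v : 𝓢'(F, ℂ)) (Φ : 𝓢(E × F, ℂ)) (x : E) :
    ∃ L : E →L[ℝ] ℂ, HasFDerivAt (fun z => v (slice z Φ)) L x ∧
      ∀ m, L m = v (slice x (LineDeriv.lineDerivOpCLM ℂ 𝓢(E × F, ℂ) (m, (0 : F)) Φ)) := by
  let L₀ : E →ₗ[ℝ] ℂ :=
    { toFun := fun m => v (slice x (∂_{(m, (0 : F))} Φ))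
      map_add' := fun m m' => by
        rw [show ((m + m', (0 : F)) : E × F) = (m, 0) + (m', 0) by simp,
          LineDeriv.lineDerivOp_left_add, map_add, map_add]
      map_smul' := fun r m => by
        rw [show ((r • m, (0 : F)) : E × F) = r • (m, 0) by simp,
          LineDeriv.lineDerivOp_left_smul]
        rw [← Complex.coe_smul r, map_smul, map_smul, Complex.coe_smul]
        rfl }
  refine ⟨LinearMap.toContinuousLinearMap L₀, ?_, fun m => rfl⟩
  let q : Seminorm ℂ 𝓢(F, ℂ) := (normSeminorm ℂ ℂ).comp (v : 𝓢(F, ℂ) →ₗ[ℂ] ℂ)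
  have hq : Continuous q := continuous_norm.comp v.continuous
  obtain ⟨s, C, hC, hs⟩ := seminorm_bound hq
  rw [hasFDerivAt_iff_isLittleO_nhds_zero]
  refine Asymptotics.IsBigO.trans_isLittleO (g := fun h : E => ‖h‖ ^ 2) ?_
    (Asymptotics.isLittleO_norm_pow_id one_lt_two)
  refine Asymptotics.IsBigO.of_bound
    (C * ∑ i ∈ s, SchwartzMap.seminorm ℂ i.1 (i.2 + 2) Φ) (Filter.Eventually.of_forall fun h => ?_)
  have h1 : v (slice (x + h) Φ) - v (slice x Φ) - LinearMap.toContinuousLinearMap L₀ h =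
      v (slice (x + h) Φ - slice x Φ - slice x (∂_{(h, (0 : F))} Φ)) := by
    rw [map_sub, map_sub]; rfl
  rw [h1, Real.norm_of_nonneg (by positivity : (0 : ℝ) ≤ ‖h‖ ^ 2)]
  refine (hs _).trans ?_
  rw [mul_assoc, Finset.sum_mul]
  gcongr
  refine (Seminorm.finset_sup_le_sum (schwartzSeminormFamily ℂ F ℂ) s _).trans ?_
  rw [seminorm_sum_apply]
  exact Finset.sum_le_sum fun i _ => seminorm_slice_remainder _ _ _ _ _

/-- Partial evaluation `Φ ↦ (x ↦ v (Φ (x, ·)))` of a tempered distribution `v`. -/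
def partialEval (v : 𝓢'(F, ℂ)) : 𝓢(E × F, ℂ) →L[ℂ] 𝓢(E, ℂ) :=
  paramCLM (fun Φ x => v (slice x Φ)) (fun m => LineDeriv.lineDerivOpCLM ℂ 𝓢(E × F, ℂ) (m, (0 : F)))
    (fun f g x => by rw [map_add, map_add]) (fun c f x => by rw [map_smul, map_smul])
    (fun Φ x => hasFDerivAt_apply_slice v Φ x)
    (fun k => slice_decay (q := (normSeminorm ℂ ℂ).comp (v : 𝓢(F, ℂ) →ₗ[ℂ] ℂ))
      (continuous_norm.comp v.continuous) k)

@[simp] theorem partialEval_apply (v : 𝓢'(F, ℂ)) (Φ : 𝓢(E × F, ℂ)) (x : E) :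
    partialEval v Φ x = v (slice x Φ) := rfl

/-- The tensor product `u ⊗ v` of tempered distributions,
`(u ⊗ v)(Φ) = u (x ↦ v (y ↦ Φ (x, y)))`. -/
def tensorDistribution (u : 𝓢'(E, ℂ)) (v : 𝓢'(F, ℂ)) : 𝓢'(E × F, ℂ) :=
  PointwiseConvergenceCLM.precomp ℂ (partialEval v) u

theorem tensorDistribution_apply (u : 𝓢'(E, ℂ)) (v : 𝓢'(F, ℂ)) (Φ : 𝓢(E × F, ℂ)) :
    tensorDistribution u v Φ = u (partialEval v Φ) := rfl

end DistributionTensor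

section PartialFourier

variable {E V : Type*} [NormedAddCommGroup E] [NormedSpace ℝ E] [FiniteDimensional ℝ E]
  [NormedAddCommGroup V] [InnerProductSpace ℝ V] [FiniteDimensional ℝ V]
  [MeasurableSpace V] [BorelSpace V]

/-- The unnormalized partial Fourier integral in the second variable. -/
def partialFourierIntegral (Φ : 𝓢(E × V, ℂ)) (p : E × V) : ℂ :=
  ∫ y : V, Φ (p.1, y) * Complex.exp (-Complex.I * (inner ℝ y p.2 : ℝ))

theorem norm_exp_neg_I_mul (t : ℝ) : ‖Complex.exp (-Complex.I * (t : ℂ))‖ = 1 := by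
  rw [show -Complex.I * (t : ℂ) = ((-t : ℝ) : ℂ) * Complex.I by push_cast; ring]
  exact Complex.norm_exp_ofReal_mul_I _

theorem integrable_mul_exp (f : 𝓢(V, ℂ)) (ξ : V) :
    Integrable (fun y : V => f y * Complex.exp (-Complex.I * (inner ℝ y ξ : ℝ))) := by
  refine f.integrable.mul_bdd (c := 1) (by fun_prop) (Filter.Eventually.of_forall fun y => ?_)
  exact (norm_exp_neg_I_mul _).le

theorem partialFourierIntegral_eq (Φ : 𝓢(E × V, ℂ)) (p : E × V) :
    partialFourierIntegral Φ p =
      FourierTransform.fourier (slice p.1 Φ) ((2 * Real.pi)⁻¹ • p.2) := by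
  rw [SchwartzMap.fourier_coe, Real.fourier_eq]
  refine integral_congr_ae (Filter.Eventually.of_forall fun y => ?_)
  simp only [slice_apply, Circle.smul_def, smul_eq_mul, Real.fourierChar_apply, inner_smul_right]
  rw [mul_comm]
  congr 2
  push_cast
  have := Real.pi_ne_zero
  field_simp

theorem exists_decay_bound {W : Type*} [NormedAddCommGroup W] [NormedSpace ℝ W]
    (Φ : 𝓢(W, ℂ)) (k n : ℕ) :
    ∃ C : ℝ, 0 ≤ C ∧ ∀ z, (1 + ‖z‖) ^ k * ‖iteratedFDeriv ℝ n Φ z‖ ≤ C :=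
  ⟨_, by positivity, fun z => SchwartzMap.one_add_le_sup_seminorm_apply (𝕜 := ℂ) (m := (k, n))
    le_rfl le_rfl Φ z⟩

theorem hasTemperateGrowth_inner_snd (m : V) :
    (fun q : E × V => -Complex.I * ((inner ℝ q.2 m : ℝ) : ℂ)).HasTemperateGrowth := by
  have : (fun q : E × V => -Complex.I * ((inner ℝ q.2 m : ℝ) : ℂ)) = fun q =>
      ((-Complex.I) • (Complex.ofRealCLM.comp ((innerSL ℝ m).comp
        (ContinuousLinearMap.snd ℝ E V)))) q := by
    funext q
    simp [real_inner_comm]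
  rw [this]
  exact ContinuousLinearMap.hasTemperateGrowth _

/-- The derivative of the partial Fourier integral in direction `m`, on the level of symbols. -/
def partialFourierDeriv (m : E × V) : 𝓢(E × V, ℂ) →L[ℂ] 𝓢(E × V, ℂ) :=
  LineDeriv.lineDerivOpCLM ℂ 𝓢(E × V, ℂ) (m.1, (0 : V)) +
    SchwartzMap.smulLeftCLM ℂ (fun q : E × V => -Complex.I * ((inner ℝ q.2 m.2 : ℝ) : ℂ))

theorem hasFDerivAt_oscillatory {W : Type*} [NormedAddCommGroup W] [NormedSpace ℝ W]
    (π₁ : W →L[ℝ] E) (π₂ : W →L[ℝ] V) (Φ : 𝓢(E × V, ℂ)) (p : W) :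
    ∃ L : W →L[ℝ] ℂ, HasFDerivAt (fun q : W =>
        ∫ y : V, Φ (π₁ q, y) * Complex.exp (-Complex.I * (inner ℝ y (π₂ q) : ℝ))) L p ∧
      ∀ m, L m = ∫ y : V, (fderiv ℝ Φ (π₁ p, y) (π₁ m, 0) +
        -Complex.I * (inner ℝ y (π₂ m) : ℝ) * Φ (π₁ p, y)) *
          Complex.exp (-Complex.I * (inner ℝ y (π₂ p) : ℝ)) := by
  let e : W → V → ℂ := fun q y => Complex.exp (-Complex.I * (inner ℝ y (π₂ q) : ℝ))
  let G : V → W →L[ℝ] ℂ := fun y =>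
    (-Complex.I) • (Complex.ofRealCLM.comp ((innerSL ℝ y).comp π₂))
  let P : W →L[ℝ] E × V := (ContinuousLinearMap.inl ℝ E V).comp π₁
  let F' : W → V → W →L[ℝ] ℂ := fun q y =>
    Φ (π₁ q, y) • (e q y • G y) + e q y • (fderiv ℝ Φ (π₁ q, y)).comp P
  have hG (q : W) (y : V) : G y q = -Complex.I * (inner ℝ y (π₂ q) : ℝ) := by simp [G]
  have hdiff (q : W) (y : V) :
      HasFDerivAt (fun q : W => Φ (π₁ q, y) * e q y) (F' q y) q := by
    have h1 : HasFDerivAt (fun q : W => Φ (π₁ q, y)) ((fderiv ℝ Φ (π₁ q, y)).comp P) q := by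
      have h2 : HasFDerivAt (fun q : W => (π₁ q, y)) P q := by
        have : (fun q : W => (π₁ q, y)) = fun q => P q + (0, y) := by
          funext q; simp [P]
        rw [this]
        exact P.hasFDerivAt.add_const _
      exact HasFDerivAt.comp (g := Φ) q (Φ.differentiableAt (x := (π₁ q, y))).hasFDerivAt h2
    have h3 : HasFDerivAt (fun q : W => e q y) (e q y • G y) q := by
      have : (fun q : W => e q y) = fun q => Complex.exp (G y q) := by
        funext q; simp only [e, hG]
      rw [this, show e q y = Complex.exp (G y q) by simp only [e, hG]]
      exact (G y).hasFDerivAt.cexp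
    exact h1.mul h3
  obtain ⟨C0, hC0, h0⟩ := exists_decay_bound Φ (Module.finrank ℝ V + 1 + 1) 0
  obtain ⟨C1, hC1, h1⟩ := exists_decay_bound Φ (Module.finrank ℝ V + 1) 1
  have he (q : W) (y : V) : ‖e q y‖ = 1 := norm_exp_neg_I_mul _
  have hGn (y : V) : ‖G y‖ ≤ ‖π₂‖ * ‖y‖ := by
    refine ContinuousLinearMap.opNorm_le_bound _ (by positivity) fun q => ?_
    rw [hG, norm_mul, norm_neg, Complex.norm_I, one_mul, Complex.norm_real]
    calc
      _ ≤ ‖y‖ * ‖π₂ q‖ := norm_inner_le_norm _ _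
      _ ≤ ‖y‖ * (‖π₂‖ * ‖q‖) := by gcongr; exact π₂.le_opNorm q
      _ = _ := by ring
  have hbound (q : W) (y : V) : ‖F' q y‖ ≤
      (C0 * ‖π₂‖ + C1 * ‖P‖) * (1 + ‖y‖) ^ (-((Module.finrank ℝ V + 1 : ℕ) : ℝ)) := by
    have hy : 0 < 1 + ‖y‖ := by positivity
    have hle : 1 + ‖y‖ ≤ 1 + ‖(π₁ q, y)‖ := by gcongr; exact norm_snd_le (π₁ q, y)
    have a0 : ‖Φ (π₁ q, y)‖ * ‖y‖ ≤ C0 / (1 + ‖y‖) ^ (Module.finrank ℝ V + 1) := by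
      rw [le_div_iff₀' (by positivity)]
      refine le_trans ?_ (h0 (π₁ q, y))
      rw [norm_iteratedFDeriv_zero, pow_succ _ (Module.finrank ℝ V + 1), mul_assoc, mul_comm ‖Φ _‖]
      gcongr
      exact (norm_snd_le (π₁ q, y)).trans (by simp)
    have a1 : ‖fderiv ℝ Φ (π₁ q, y)‖ ≤ C1 / (1 + ‖y‖) ^ (Module.finrank ℝ V + 1) := by
      rw [le_div_iff₀' (by positivity)]
      refine le_trans ?_ (h1 (π₁ q, y))
      rw [norm_iteratedFDeriv_one]
      gcongr
    rw [Real.rpow_neg hy.le, Real.rpow_natCast]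
    calc
      _ ≤ ‖Φ (π₁ q, y)‖ * (‖e q y‖ * ‖G y‖) + ‖e q y‖ * (‖fderiv ℝ Φ (π₁ q, y)‖ * ‖P‖) := by
        have t1 : ‖Φ (π₁ q, y) • (e q y • G y)‖ = ‖Φ (π₁ q, y)‖ * (‖e q y‖ * ‖G y‖) := by
          rw [norm_smul, norm_smul]
        have t2 : ‖e q y • (fderiv ℝ Φ (π₁ q, y)).comp P‖ ≤
            ‖e q y‖ * (‖fderiv ℝ Φ (π₁ q, y)‖ * ‖P‖) := by
          rw [norm_smul]
          gcongr
          exact ContinuousLinearMap.opNorm_comp_le _ _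
        exact (norm_add_le _ _).trans (add_le_add t1.le t2)
      _ ≤ ‖Φ (π₁ q, y)‖ * (1 * (‖π₂‖ * ‖y‖)) + 1 * (‖fderiv ℝ Φ (π₁ q, y)‖ * ‖P‖) := by
        rw [he]
        gcongr
        exact hGn y
      _ = ‖Φ (π₁ q, y)‖ * ‖y‖ * ‖π₂‖ + ‖fderiv ℝ Φ (π₁ q, y)‖ * ‖P‖ := by ring
      _ ≤ C0 / (1 + ‖y‖) ^ (Module.finrank ℝ V + 1) * ‖π₂‖ +
          C1 / (1 + ‖y‖) ^ (Module.finrank ℝ V + 1) * ‖P‖ := by gcongr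
      _ = _ := by ring
  have hcont_e (q : W) : Continuous (e q) := by fun_prop
  have hcont_G : Continuous G := by
    have : Continuous fun y : V => Complex.ofRealCLM.comp ((innerSL ℝ y).comp π₂) :=
      continuous_const.clm_comp ((innerSL ℝ).continuous.clm_comp continuous_const)
    exact this.const_smul (-Complex.I)
  have hcont (q : W) : Continuous (F' q) := by
    have c1 : Continuous fun y : V => Φ (π₁ q, y) := Φ.continuous.comp (by fun_prop)
    have c2 : Continuous fun y : V => fderiv ℝ Φ (π₁ q, y) :=
      ((Φ.smooth 1).continuous_fderiv (by norm_num)).comp (by fun_prop)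
    exact (c1.smul ((hcont_e q).smul hcont_G)).add ((hcont_e q).smul (c2.clm_comp continuous_const))
  have hint : Integrable (fun y : V =>
      (C0 * ‖π₂‖ + C1 * ‖P‖) * (1 + ‖y‖) ^ (-((Module.finrank ℝ V + 1 : ℕ) : ℝ))) :=
    (integrable_one_add_norm (by push_cast; linarith)).const_mul _
  have hF'int : Integrable (F' p) :=
    hint.mono' (hcont p).aestronglyMeasurable (Filter.Eventually.of_forall (hbound p))
  refine ⟨∫ y, F' p y, ?_, fun m => ?_⟩
  · refine hasFDerivAt_integral_of_dominated_of_fderiv_le (F := fun q y => Φ (π₁ q, y) * e q y)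
      (F' := F') Filter.univ_mem
      (Filter.Eventually.of_forall fun q => (integrable_mul_exp (slice (π₁ q) Φ) (π₂ q)).1)
      (integrable_mul_exp (slice (π₁ p) Φ) (π₂ p)) (hcont p).aestronglyMeasurable
      (Filter.Eventually.of_forall fun y q _ => hbound q y) hint
      (Filter.Eventually.of_forall fun y q _ => hdiff q y)
  · rw [ContinuousLinearMap.integral_apply hF'int]
    refine integral_congr_ae (Filter.Eventually.of_forall fun y => ?_)
    have hPm : P m = (π₁ m, 0) := by simp [P]
    simp only [F', e, add_apply, smul_apply, ContinuousLinearMap.comp_apply, hPm, hG, smul_eq_mul]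
    ring

theorem partialFourierDeriv_apply (m : E × V) (Φ : 𝓢(E × V, ℂ)) (q : E × V) :
    partialFourierDeriv m Φ q =
      fderiv ℝ Φ q (m.1, 0) + -Complex.I * (inner ℝ q.2 m.2 : ℝ) * Φ q := by
  change (LineDeriv.lineDerivOp (m.1, (0 : V)) Φ : 𝓢(E × V, ℂ)) q +
    SchwartzMap.smulLeftCLM ℂ _ Φ q = _
  rw [SchwartzMap.lineDerivOp_apply_eq_fderiv,
    SchwartzMap.smulLeftCLM_apply_apply (hasTemperateGrowth_inner_snd m.2)]
  rfl

theorem hasFDerivAt_partialFourierIntegral (Φ : 𝓢(E × V, ℂ)) (p : E × V) :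
    ∃ L : E × V →L[ℝ] ℂ, HasFDerivAt (partialFourierIntegral Φ) L p ∧
      ∀ m, L m = partialFourierIntegral (partialFourierDeriv m Φ) p := by
  obtain ⟨L, hL, h⟩ := hasFDerivAt_oscillatory (ContinuousLinearMap.fst ℝ E V)
    (ContinuousLinearMap.snd ℝ E V) Φ p
  refine ⟨L, hL, fun m => (h m).trans ?_⟩
  unfold partialFourierIntegral
  simp only [partialFourierDeriv_apply]
  rfl

theorem partialFourierIntegral_decay (k : ℕ) : ∃ q : Seminorm ℂ 𝓢(E × V, ℂ), Continuous q ∧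
    ∀ Φ p, ‖p‖ ^ k * ‖partialFourierIntegral Φ p‖ ≤ q Φ := by
  let r (j : ℕ) : Seminorm ℂ 𝓢(V, ℂ) := ((2 * Real.pi) ^ j).toNNReal •
    (SchwartzMap.seminorm ℂ j 0).comp (SchwartzMap.fourierTransformCLM ℂ).toLinearMap
  have hr_apply (j : ℕ) (g : 𝓢(V, ℂ)) :
      r j g = (2 * Real.pi) ^ j * SchwartzMap.seminorm ℂ j 0 (FourierTransform.fourier g) := by
    change (((2 * Real.pi) ^ j).toNNReal : ℝ) * _ = _
    rw [Real.coe_toNNReal _ (by positivity)]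
    rfl
  have hr (j : ℕ) : Continuous (r j) := by
    rw [show (r j : 𝓢(V, ℂ) → ℝ) = _ from funext (hr_apply j)]
    exact continuous_const.mul (((schwartz_withSeminorms ℂ V ℂ).continuous_seminorm (j, 0)).comp
      (SchwartzMap.fourierTransformCLM ℂ).continuous)
  have hle (j : ℕ) (Φ : 𝓢(E × V, ℂ)) (p : E × V) :
      ‖p.2‖ ^ j * ‖partialFourierIntegral Φ p‖ ≤ r j (slice p.1 Φ) := by
    rw [hr_apply, partialFourierIntegral_eq]
    have := SchwartzMap.le_seminorm ℂ j 0 (FourierTransform.fourier (slice p.1 Φ))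
      ((2 * Real.pi)⁻¹ • p.2)
    rw [norm_iteratedFDeriv_zero, norm_smul, Real.norm_of_nonneg (by positivity), mul_pow,
      inv_pow, mul_assoc, inv_mul_le_iff₀ (by positivity)] at this
    exact this
  obtain ⟨q1, hq1, h1⟩ := slice_decay (E := E) (hr 0) k
  obtain ⟨q2, hq2, h2⟩ := slice_decay (E := E) (hr k) 0
  refine ⟨q1 + q2, hq1.add hq2, fun Φ p => ?_⟩
  calc
    _ ≤ (‖p.1‖ ^ k + ‖p.2‖ ^ k) * ‖partialFourierIntegral Φ p‖ := by
      gcongr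
      rcases le_total ‖p.1‖ ‖p.2‖ with h | h
      · rw [Prod.norm_def, max_eq_right h]; simp
      · rw [Prod.norm_def, max_eq_left h]; simp
    _ ≤ q1 Φ + q2 Φ := by
      rw [add_mul]
      refine add_le_add (le_trans ?_ (h1 Φ p.1)) (le_trans ?_ (h2 Φ p.1))
      · gcongr
        simpa using hle 0 Φ p
      · simpa using hle k Φ p

/-- The partial Fourier transform in the second variable,
`(x, ξ) ↦ (2π)^(-dim V / 2) ∫ Φ (x, y) e^{-i⟨y, ξ⟩} dy`, as an operator on Schwartz functions. -/
def partialFourier : 𝓢(E × V, ℂ) →L[ℂ] 𝓢(E × V, ℂ) :=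
  (((2 * Real.pi) ^ (-(Module.finrank ℝ V : ℝ) / 2) : ℝ) : ℂ) •
    paramCLM partialFourierIntegral partialFourierDeriv
      (fun f g p => by
        unfold partialFourierIntegral
        refine Eq.trans ?_ (integral_add (integrable_mul_exp (slice p.1 f) p.2)
          (integrable_mul_exp (slice p.1 g) p.2))
        simp only [add_apply, add_mul])
      (fun c f p => by
        unfold partialFourierIntegral
        rw [← integral_smul]
        simp only [smul_apply, smul_eq_mul, mul_assoc])
      hasFDerivAt_partialFourierIntegral partialFourierIntegral_decay

theorem partialFourier_apply (Φ : 𝓢(E × V, ℂ)) (x : E) (ξ : V) :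
    partialFourier Φ (x, ξ) = (((2 * Real.pi) ^ (-(Module.finrank ℝ V : ℝ) / 2) : ℝ) : ℂ) *
      ∫ y : V, Φ (x, y) * Complex.exp (-Complex.I * (inner ℝ y ξ : ℝ)) := rfl

end PartialFourier

section Weyl

/-- The tensor product `f ⊗ g : (x, y) ↦ f x * g y` of Schwartz functions, linear in `g`. -/
def tensorSchwartz {E F : Type*} [NormedAddCommGroup E] [NormedSpace ℝ E]
    [NormedAddCommGroup F] [NormedSpace ℝ F] (f : 𝓢(E, ℂ)) : 𝓢(F, ℂ) →L[ℂ] 𝓢(E × F, ℂ) :=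
  SchwartzMap.mkCLM (fun g p => f p.1 * g p.2)
    (fun g h p => by simp [mul_add]) (fun c g p => by simp; ring)
    (fun g => (f.smooth'.comp contDiff_fst).mul (g.smooth'.comp contDiff_snd)) (by
      rintro ⟨k, n⟩
      let B : ℕ × ℕ → ℝ := fun i => SchwartzMap.seminorm ℂ i.1 i.2 f
      refine ⟨Finset.Iic (k, n), ∑ i ∈ Finset.range (n + 1),
        (n.choose i : ℝ) * (B (k, i) + B (0, i)), ?_, fun g p => ?_⟩
      · exact Finset.sum_nonneg fun i _ => mul_nonneg (Nat.cast_nonneg _)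
          (add_nonneg (apply_nonneg _ _) (apply_nonneg _ _))
      set S := (Finset.Iic (k, n)).sup (schwartzSeminormFamily ℂ F ℂ) g with hS
      have hS0 : 0 ≤ S := apply_nonneg _ _
      have hle (j i : ℕ) (hj : j ≤ k) (hi : i ≤ n) : ‖p.2‖ ^ j * ‖iteratedFDeriv ℝ i g p.2‖ ≤ S :=
        (SchwartzMap.le_seminorm ℂ j i g p.2).trans
          (Seminorm.le_def.1 (Finset.le_sup (f := schwartzSeminormFamily ℂ F ℂ)
            (b := (j, i)) (by simp [hj, hi])) g)
      have hpow : ‖p‖ ^ k ≤ ‖p.1‖ ^ k + ‖p.2‖ ^ k := by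
        rcases le_total ‖p.1‖ ‖p.2‖ with h | h
        · rw [Prod.norm_def, max_eq_right h]; simp
        · rw [Prod.norm_def, max_eq_left h]; simp
      have hf (i : ℕ) : ‖iteratedFDeriv ℝ i (fun p : E × F => f p.1) p‖ ≤
          ‖iteratedFDeriv ℝ i f p.1‖ := by
        have := ContinuousLinearMap.iteratedFDeriv_comp_right (ContinuousLinearMap.fst ℝ E F)
          (f.smooth i) p le_rfl
        change ‖iteratedFDeriv ℝ i (f ∘ ContinuousLinearMap.fst ℝ E F) p‖ ≤ _
        rw [this]
        refine (ContinuousMultilinearMap.norm_compContinuousLinearMap_le _ _).trans ?_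
        exact mul_le_of_le_one_right (norm_nonneg _) (Finset.prod_le_one (by simp) fun _ _ =>
          ContinuousLinearMap.norm_fst_le ℝ E F)
      have hg (i : ℕ) : ‖iteratedFDeriv ℝ i (fun p : E × F => g p.2) p‖ ≤
          ‖iteratedFDeriv ℝ i g p.2‖ := by
        have := ContinuousLinearMap.iteratedFDeriv_comp_right (ContinuousLinearMap.snd ℝ E F)
          (g.smooth i) p le_rfl
        change ‖iteratedFDeriv ℝ i (g ∘ ContinuousLinearMap.snd ℝ E F) p‖ ≤ _
        rw [this]
        refine (ContinuousMultilinearMap.norm_compContinuousLinearMap_le _ _).trans ?_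
        exact mul_le_of_le_one_right (norm_nonneg _) (Finset.prod_le_one (by simp) fun _ _ =>
          ContinuousLinearMap.norm_snd_le ℝ E F)
      have hmul := norm_iteratedFDeriv_mul_le (𝕜 := ℝ) (N := ∞) (n := n)
        (f.smooth'.comp (contDiff_fst (E := E) (F := F)))
        (g.smooth'.comp (contDiff_snd (E := E) (F := F))) p (mod_cast le_top)
      calc
        _ ≤ (‖p.1‖ ^ k + ‖p.2‖ ^ k) * ∑ i ∈ Finset.range (n + 1), (n.choose i : ℝ) *
            ‖iteratedFDeriv ℝ i f p.1‖ * ‖iteratedFDeriv ℝ (n - i) g p.2‖ := by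
          gcongr
          refine hmul.trans ?_
          gcongr with i _
          · exact hf i
          · exact hg (n - i)
        _ = ∑ i ∈ Finset.range (n + 1), (n.choose i : ℝ) *
            ((‖p.1‖ ^ k * ‖iteratedFDeriv ℝ i f p.1‖) *
                (‖p.2‖ ^ 0 * ‖iteratedFDeriv ℝ (n - i) g p.2‖) +
              (‖p.1‖ ^ 0 * ‖iteratedFDeriv ℝ i f p.1‖) *
                (‖p.2‖ ^ k * ‖iteratedFDeriv ℝ (n - i) g p.2‖)) := by
          rw [Finset.mul_sum]
          exact Finset.sum_congr rfl fun i _ => by ring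
        _ ≤ ∑ i ∈ Finset.range (n + 1), (n.choose i : ℝ) * (B (k, i) * S + B (0, i) * S) := by
          gcongr with i _
          · exact SchwartzMap.le_seminorm ℂ k i f p.1
          · exact hle 0 (n - i) (Nat.zero_le _) (Nat.sub_le _ _)
          · exact SchwartzMap.le_seminorm ℂ 0 i f p.1
          · exact hle k (n - i) le_rfl (Nat.sub_le _ _)
        _ = _ := by
          rw [Finset.sum_mul]
          exact Finset.sum_congr rfl fun i _ => by ring)

/-- Pointwise complex conjugation of a Schwartz function. -/
def conjSchwartz {E : Type*} [NormedAddCommGroup E] [NormedSpace ℝ E] (f : 𝓢(E, ℂ)) : 𝓢(E, ℂ) :=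
  SchwartzMap.postcompCLM (𝕜 := ℝ) (Complex.conjCLE : ℂ →L[ℝ] ℂ) f

/-- The conjugate linear action `(u, φ)` of a tempered distribution `u` on a Schwartz function
`φ`, which extends the `L²` inner product `∫ u φ̄`. -/
def pairing {E : Type*} [NormedAddCommGroup E] [NormedSpace ℝ E]
    (u : 𝓢'(E, ℂ)) (φ : 𝓢(E, ℂ)) : ℂ :=
  u (conjSchwartz φ)

variable {V : Type*} [NormedAddCommGroup V] [InnerProductSpace ℝ V] [FiniteDimensional ℝ V]

/-- The linear coordinate change `κ (x, y) = (x + y/2, x - y/2)`. -/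
def kappa (V : Type*) [NormedAddCommGroup V] [InnerProductSpace ℝ V] [FiniteDimensional ℝ V] :
    (V × V) ≃L[ℝ] (V × V) :=
  LinearEquiv.toContinuousLinearEquiv
    { toFun := fun p => (p.1 + (1 / 2 : ℝ) • p.2, p.1 - (1 / 2 : ℝ) • p.2)
      invFun := fun p => ((1 / 2 : ℝ) • (p.1 + p.2), p.1 - p.2)
      map_add' := fun p q => by ext <;> simp <;> module
      map_smul' := fun c p => by ext <;> simp <;> module
      left_inv := fun p => by ext <;> simp <;> module
      right_inv := fun p => by ext <;> simp <;> module }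

variable [MeasurableSpace V] [BorelSpace V]

/-- `f ↦ (g ↦ ℱ₂ ((f ⊗ g) ∘ κ))`, which is `W(f, ḡ)`. -/
def wignerCLM (f : 𝓢(V, ℂ)) : 𝓢(V, ℂ) →L[ℂ] 𝓢(V × V, ℂ) :=
  partialFourier ∘L SchwartzMap.compCLMOfContinuousLinearEquiv ℂ (kappa V) ∘L tensorSchwartz f

/-- The cross-Wigner distribution `W(g, f) = ℱ₂ ((g ⊗ f̄) ∘ κ)` of Schwartz functions. -/
def wigner (g f : 𝓢(V, ℂ)) : 𝓢(V × V, ℂ) :=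
  wignerCLM g (conjSchwartz f)

theorem wigner_apply (g f : 𝓢(V, ℂ)) (x ξ : V) :
    wigner g f (x, ξ) = (((2 * Real.pi) ^ (-(Module.finrank ℝ V : ℝ) / 2) : ℝ) : ℂ) *
      ∫ y : V, g (x + (1 / 2 : ℝ) • y) * starRingEnd ℂ (f (x - (1 / 2 : ℝ) • y)) *
        Complex.exp (-Complex.I * (inner ℝ y ξ : ℝ)) := rfl

theorem conj_wigner (g f : 𝓢(V, ℂ)) : conjSchwartz (wigner g f) = wigner f g := by
  ext ⟨x, ξ⟩
  change starRingEnd ℂ (wigner g f (x, ξ)) = _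
  rw [wigner_apply, wigner_apply, map_mul, Complex.conj_ofReal, ← integral_conj,
    ← integral_neg_eq_self]
  congr 2
  funext y
  simp only [map_mul, Complex.conj_conj, ← Complex.exp_conj, map_neg, Complex.conj_I,
    Complex.conj_ofReal, smul_neg, sub_neg_eq_add, inner_neg_left, Complex.ofReal_neg,
    ← sub_eq_add_neg]
  ring_nf

/-- The Weyl quantization `σʷ(x, D) : 𝓢(V) → 𝓢'(V)` of a symbol `σ ∈ 𝓢'(V × V)`, i.e. the operator
with `(σʷ(x, D) f, g) = (2π)^(-dim V / 2) (σ, W(g, f))`; see `pairing_weylOp`. -/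
def weylOp (σ : 𝓢'(V × V, ℂ)) (f : 𝓢(V, ℂ)) : 𝓢'(V, ℂ) :=
  (((2 * Real.pi) ^ (-(Module.finrank ℝ V : ℝ) / 2) : ℝ) : ℂ) •
    PointwiseConvergenceCLM.precomp ℂ (wignerCLM f) σ

theorem pairing_weylOp (σ : 𝓢'(V × V, ℂ)) (f g : 𝓢(V, ℂ)) :
    pairing (weylOp σ f) g =
      (((2 * Real.pi) ^ (-(Module.finrank ℝ V : ℝ) / 2) : ℝ) : ℂ) * pairing σ (wigner g f) := by
  unfold pairing
  rw [conj_wigner]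
  rfl

open scoped ComplexOrder in
/-- Non-negativity on `𝓢(V)` of an operator `T : 𝓢(V) → 𝓢'(V)`: `(T f, f) ≥ 0` for all `f`
(in particular `(T f, f)` is real). -/
def IsNonnegOp {E : Type*} [NormedAddCommGroup E] [NormedSpace ℝ E]
    (T : 𝓢(E, ℂ) → 𝓢'(E, ℂ)) : Prop :=
  ∀ f : 𝓢(E, ℂ), 0 ≤ pairing (T f) f

end Weyl

section Doubling

/-- The composition `u ∘ T` of a tempered distribution with a linear isomorphism that preserves
Lebesgue measure (so that the Jacobian factor is one): `(u ∘ T)(φ) = u (φ ∘ T⁻¹)`. -/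
def compMeasurePreserving {D E : Type*} [NormedAddCommGroup D] [NormedSpace ℝ D] [MeasureSpace D]
    [NormedAddCommGroup E] [NormedSpace ℝ E] [MeasureSpace E] (T : D ≃L[ℝ] E)
    (_hT : MeasurePreserving T) (u : 𝓢'(E, ℂ)) : 𝓢'(D, ℂ) :=
  PointwiseConvergenceCLM.precomp ℂ (SchwartzMap.compCLMOfContinuousLinearEquiv ℂ T.symm) u

variable (E : Type*) [NormedAddCommGroup E] [InnerProductSpace ℝ E] [FiniteDimensional ℝ E]

/-- The map `(x₁, x₂, ξ₁, ξ₂) ↦ ((x₁ - ξ₂/2, x₂ + ξ₁/2), (x₁ + ξ₂/2, x₂ - ξ₁/2))`, where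
`WithLp 2 (E × E)` is the Euclidean product, with points `x = (x₁, x₂)` and `ξ = (ξ₁, ξ₂)`. -/
def doublingEquiv :
    (WithLp 2 (E × E) × WithLp 2 (E × E)) ≃L[ℝ] ((E × E) × (E × E)) :=
  LinearEquiv.toContinuousLinearEquiv
    { toFun := fun p =>
        ((p.1.fst - (1 / 2 : ℝ) • p.2.snd, p.1.snd + (1 / 2 : ℝ) • p.2.fst),
          (p.1.fst + (1 / 2 : ℝ) • p.2.snd, p.1.snd - (1 / 2 : ℝ) • p.2.fst))
      invFun := fun p =>
        (WithLp.toLp 2 ((1 / 2 : ℝ) • (p.1.1 + p.2.1), (1 / 2 : ℝ) • (p.1.2 + p.2.2)),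
          WithLp.toLp 2 (p.1.2 - p.2.2, p.2.1 - p.1.1))
      map_add' := fun p q => by ext <;> simp <;> module
      map_smul' := fun c p => by ext <;> simp <;> module
      left_inv := fun p => by
        apply Prod.ext <;> apply (WithLp.equiv 2 (E × E)).injective <;> ext <;> simp <;> module
      right_inv := fun p => by ext <;> simp <;> module }

theorem doublingEquiv_apply (x ξ : WithLp 2 (E × E)) : doublingEquiv E (x, ξ) =
    ((x.fst - (1 / 2 : ℝ) • ξ.snd, x.snd + (1 / 2 : ℝ) • ξ.fst),
      (x.fst + (1 / 2 : ℝ) • ξ.snd, x.snd - (1 / 2 : ℝ) • ξ.fst)) := rfl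

variable [MeasurableSpace E] [BorelSpace E]

theorem measurePreserving_doublingEquiv : MeasurePreserving (doublingEquiv E) := by
  have hL : (volume : Measure (E × E)).IsAddLeftInvariant :=
    inferInstanceAs ((volume : Measure E).prod (volume : Measure E)).IsAddLeftInvariant
  have hR : (volume : Measure (E × E)).IsAddRightInvariant :=
    inferInstanceAs ((volume : Measure E).prod (volume : Measure E)).IsAddRightInvariant
  have h1 : MeasurePreserving
      (Prod.map (WithLp.ofLp (p := 2) (V := E × E)) (WithLp.ofLp (p := 2) (V := E × E))) :=
    (WithLp.volume_preserving_ofLp E E).prod (WithLp.volume_preserving_ofLp E E)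
  have h2 : MeasurePreserving (fun p : (E × E) × (E × E) =>
      (p.1 + (-(1 / 2 : ℝ) • p.2.2, (1 / 2 : ℝ) • p.2.1), p.2)) := by
    have := (MeasurePreserving.id (volume : Measure (E × E))).skew_product
      (μc := (volume : Measure (E × E))) (μd := (volume : Measure (E × E)))
      (g := fun (w p : E × E) => p + (-(1 / 2 : ℝ) • w.2, (1 / 2 : ℝ) • w.1)) (by fun_prop)
      (Filter.Eventually.of_forall fun w => (measurePreserving_add_right _ _).map_eq)
    exact (Measure.measurePreserving_swap.comp this).comp Measure.measurePreserving_swap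
  have hJ : MeasurePreserving (fun w : E × E => (w.2, -w.1)) :=
    ((MeasurePreserving.id (volume : Measure E)).prod
      (Measure.measurePreserving_neg (volume : Measure E))).comp Measure.measurePreserving_swap
  have h3 : MeasurePreserving (fun p : (E × E) × (E × E) => (p.1, p.1 + (p.2.2, -p.2.1))) := by
    exact (MeasurePreserving.id (volume : Measure (E × E))).skew_product
      (μc := (volume : Measure (E × E))) (μd := (volume : Measure (E × E)))
      (g := fun (p w : E × E) => p + (w.2, -w.1)) (by fun_prop)
      (Filter.Eventually.of_forall fun p =>
        ((measurePreserving_add_left volume p).comp hJ).map_eq)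
  have h := (h3.comp h2).comp h1
  convert h using 1
  funext p
  obtain ⟨x, ξ⟩ := p
  rw [doublingEquiv_apply]
  ext <;> simp <;> module

variable {E}

/-- The symbol `b(x₁, x₂, ξ₁, ξ₂) = a(x₁ - ξ₂/2, x₂ + ξ₁/2) a(x₁ + ξ₂/2, x₂ - ξ₁/2)`, i.e. the
tensor product `a ⊗ a` composed with `doublingEquiv`. -/
def doubledSymbol (a : 𝓢'(E × E, ℂ)) : 𝓢'(WithLp 2 (E × E) × WithLp 2 (E × E), ℂ) :=
  compMeasurePreserving (doublingEquiv E) (measurePreserving_doublingEquiv E)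
    (tensorDistribution a a)

end Doubling

end WeylCalculus

end

/-! The Weyl form of `a` is B(f, g) = a(W(f, g)), where W is the cross-Wigner distribution, and
positivity of the operator says B(f, f) ≥ 0 for all f (`isNonnegOp_weylOp_iff`). The theorem rests
on an explicit formula for Wigner distributions of Wigner distributions, `wigner_wignerLp`: W(W(f,
g), W(f', g')) is W(f, f') ⊗ W(g', g) composed with exactly the linear map that defines the doubled
symbol b. Hence b(W(W(f, g), W(f', g'))) = a(W(f, f')) a(W(g', g)).

For a finite sum c = ∑ W(f_i, g_i) this gives b(W(c, c)) = ∑_{i,j} B(f_i, f_j) B(g_j, g_i). The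
matrix (B(f_i, f_j)) and the transpose of (B(g_i, g_j)) are positive semidefinite, so by the Schur
product theorem their entrywise product is too. Testing it on the all-ones vector gives b(W(c, c)) ≥
0 (`sum_sum_mul_nonneg`).

The passage to arbitrary c is by density (`dense_sum_wignerLp`) and continuity of c ↦ W(c, c).
Density reduces to density of finite sums of tensor products. A function c is written as a partial
Fourier integral, which after a cutoff is an integral of tensor products; a closed subspace
containing all slices of a Schwartz function contains their integral (`mem_of_forall_slice_mem`),
and the cutoff is then removed by a limit. -/

namespace WeylCalculus

/-! ### Continuity of slices in the Schwartz topology -/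

section SliceTopology

variable {E F : Type*} [NormedAddCommGroup E] [NormedSpace ℝ E]
  [NormedAddCommGroup F] [NormedSpace ℝ F]

/-- First-order Taylor expansion in h: the linear term tends to 0 because it is linear on a
finite-dimensional space, and the remainder is O(‖h‖²) in every Schwartz seminorm by
`seminorm_slice_remainder`. -/
theorem continuous_slice [FiniteDimensional ℝ E] (Φ : 𝓢(E × F, ℂ)) :
    Continuous (fun x : E => slice x Φ) := by
  refine continuous_iff_continuousAt.2 fun x => ?_
  let D : E →ₗ[ℝ] 𝓢(F, ℂ) :=
    { toFun := fun m => slice x (∂_{(m, (0 : F))} Φ)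
      map_add' := fun m m' => by
        rw [show ((m + m', (0 : F)) : E × F) = (m, 0) + (m', 0) by simp,
          LineDeriv.lineDerivOp_left_add, map_add]
      map_smul' := fun r m => by
        rw [show ((r • m, (0 : F)) : E × F) = r • (m, 0) by simp,
          LineDeriv.lineDerivOp_left_smul]
        rfl }
  have hD : Filter.Tendsto D (nhds 0) (nhds 0) := by
    have := D.continuous_of_finiteDimensional.tendsto 0
    rwa [map_zero] at this
  have hR : Filter.Tendsto (fun h => slice (x + h) Φ - slice x Φ - D h) (nhds 0) (nhds 0) := by
    rw [(schwartz_withSeminorms ℂ F ℂ).tendsto_nhds]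
    rintro ⟨k, n⟩ ε hε
    have : Filter.Tendsto (fun h : E => SchwartzMap.seminorm ℂ k (n + 2) Φ * ‖h‖ ^ 2)
        (nhds 0) (nhds 0) := by
      have : Continuous (fun h : E => SchwartzMap.seminorm ℂ k (n + 2) Φ * ‖h‖ ^ 2) := by fun_prop
      simpa using this.tendsto 0
    filter_upwards [this.eventually_lt_const hε] with h hh
    rw [sub_zero]
    exact (seminorm_slice_remainder k n Φ x h).trans_lt hh
  have h0 : Filter.Tendsto (fun h => slice (x + h) Φ) (nhds 0) (nhds (slice x Φ)) := by
    have := (hR.add hD).add_const (slice x Φ)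
    simpa using this
  have h1 : Filter.Tendsto (fun z : E => z - x) (nhds x) (nhds 0) := by
    have : Continuous (fun z : E => z - x) := by fun_prop
    simpa using this.tendsto x
  have := h0.comp h1
  simpa [ContinuousAt, Function.comp_def] using this

end SliceTopology

/-! ### Integrals of slices and closed subspaces -/

section IntegralOfSlices

variable {F V : Type*} [NormedAddCommGroup F] [NormedSpace ℝ F]
  [NormedAddCommGroup V] [InnerProductSpace ℝ V] [FiniteDimensional ℝ V]
  [MeasurableSpace V] [BorelSpace V]

/-- The space of values of the `n`-th derivative of a complex valued function on `F`. -/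
def DerivSpace (F : Type*) [NormedAddCommGroup F] [NormedSpace ℝ F] (n : ℕ) : Type _ :=
  F [×n]→L[ℝ] ℂ

noncomputable instance (n : ℕ) : NormedAddCommGroup (DerivSpace F n) :=
  inferInstanceAs (NormedAddCommGroup (F [×n]→L[ℝ] ℂ))

noncomputable instance (n : ℕ) : NormedSpace ℂ (DerivSpace F n) :=
  inferInstanceAs (NormedSpace ℂ (F [×n]→L[ℝ] ℂ))

noncomputable instance (n : ℕ) : CompleteSpace (DerivSpace F n) :=
  inferInstanceAs (CompleteSpace (F [×n]→L[ℝ] ℂ))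

/-- Evaluation at a tuple of vectors. -/
noncomputable def DerivSpace.evalCLM {n : ℕ} (m : Fin n → F) : DerivSpace F n →L[ℂ] ℂ :=
  LinearMap.mkContinuous
    { toFun := fun T => (show F [×n]→L[ℝ] ℂ from T) m
      map_add' := fun _ _ => rfl
      map_smul' := fun _ _ => rfl } (∏ i, ‖m i‖) fun T => by
    rw [mul_comm]
    exact ContinuousMultilinearMap.le_opNorm (show F [×n]→L[ℝ] ℂ from T) m

theorem DerivSpace.ext {n : ℕ} {S T : DerivSpace F n}
    (h : ∀ m, DerivSpace.evalCLM m S = DerivSpace.evalCLM m T) : S = T :=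
  ContinuousMultilinearMap.ext h

/-- The weighted derivative `‖z‖ ^ k • Dⁿ f z`. -/
noncomputable def weightedIteratedFDeriv (k n : ℕ) (f : 𝓢(F, ℂ)) (z : F) : DerivSpace F n :=
  show F [×n]→L[ℝ] ℂ from (‖z‖ ^ k) • iteratedFDeriv ℝ n f z

theorem norm_weightedIteratedFDeriv (k n : ℕ) (f : 𝓢(F, ℂ)) (z : F) :
    ‖weightedIteratedFDeriv k n f z‖ = ‖z‖ ^ k * ‖iteratedFDeriv ℝ n f z‖ := by
  change ‖(‖z‖ ^ k) • iteratedFDeriv ℝ n f z‖ = _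
  rw [norm_smul, norm_pow, norm_norm]

theorem evalCLM_weightedIteratedFDeriv (k n : ℕ) (f : 𝓢(F, ℂ)) (z : F) (m : Fin n → F) :
    DerivSpace.evalCLM m (weightedIteratedFDeriv k n f z) =
      ((‖z‖ ^ k : ℝ) : ℂ) * (∂^{m} f : 𝓢(F, ℂ)) z := by
  rw [SchwartzMap.iteratedLineDerivOp_eq_iteratedFDeriv, ← smul_eq_mul, Complex.coe_smul]
  rfl

theorem continuous_weightedIteratedFDeriv (k n : ℕ) (f : 𝓢(F, ℂ)) :
    Continuous (weightedIteratedFDeriv k n f) := by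
  have : Continuous fun z : F => (‖z‖ ^ k) • iteratedFDeriv ℝ n f z :=
    (continuous_norm.pow k).smul ((f.smooth n).continuous_iteratedFDeriv le_rfl)
  exact this

open BoundedContinuousFunction in
/-- The map `f ↦ (z ↦ ‖z‖ ^ k • Dⁿ f z)`, which turns the Schwartz seminorm of index `(k, n)` into
a sup norm. -/
noncomputable def weightedDeriv (k n : ℕ) : 𝓢(F, ℂ) →ₗ[ℂ] F →ᵇ DerivSpace F n where
  toFun f := BoundedContinuousFunction.ofNormedAddCommGroup (weightedIteratedFDeriv k n f)
    (continuous_weightedIteratedFDeriv k n f)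
    (SchwartzMap.seminorm ℂ k n f) (fun z => by
      rw [norm_weightedIteratedFDeriv]
      exact SchwartzMap.le_seminorm ℂ k n f z)
  map_add' f g := by
    ext1 z
    refine DerivSpace.ext fun m => ?_
    change DerivSpace.evalCLM m (weightedIteratedFDeriv k n (f + g) z) = DerivSpace.evalCLM m
      (weightedIteratedFDeriv k n f z + weightedIteratedFDeriv k n g z)
    rw [map_add, evalCLM_weightedIteratedFDeriv, evalCLM_weightedIteratedFDeriv,
      evalCLM_weightedIteratedFDeriv, LineDeriv.iteratedLineDerivOp_add]
    exact mul_add _ _ _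
  map_smul' c f := by
    ext1 z
    refine DerivSpace.ext fun m => ?_
    change DerivSpace.evalCLM m (weightedIteratedFDeriv k n (c • f) z) = DerivSpace.evalCLM m
      (c • weightedIteratedFDeriv k n f z)
    rw [map_smul, evalCLM_weightedIteratedFDeriv, evalCLM_weightedIteratedFDeriv,
      LineDeriv.iteratedLineDerivOp_smul]
    exact mul_left_comm _ _ _

theorem norm_weightedDeriv (k n : ℕ) (f : 𝓢(F, ℂ)) :
    ‖weightedDeriv k n f‖ = SchwartzMap.seminorm ℂ k n f := by
  refine le_antisymm ((BoundedContinuousFunction.norm_le (apply_nonneg _ _)).2 fun z =>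
    (norm_weightedIteratedFDeriv k n f z).trans_le (SchwartzMap.le_seminorm ℂ k n f z)) ?_
  refine SchwartzMap.seminorm_le_bound ℂ k n f (norm_nonneg _) fun z => ?_
  rw [← norm_weightedIteratedFDeriv]
  exact (weightedDeriv k n f).norm_coe_le_norm z

theorem integral_slice_lineDeriv [FiniteDimensional ℝ F] (w : F) (Φ : 𝓢(V × F, ℂ)) (Ψ : 𝓢(F, ℂ))
    (h : ∀ y, Ψ y = ∫ v, Φ (v, y)) (y : F) :
    (∂_{w} Ψ : 𝓢(F, ℂ)) y = ∫ v, (∂_{((0 : V), w)} Φ : 𝓢(V × F, ℂ)) (v, y) := by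
  let Φ' : 𝓢(F × V, ℂ) := SchwartzMap.compCLMOfContinuousLinearEquiv ℂ
    (ContinuousLinearEquiv.prodComm ℝ F V) Φ
  -- With zero frequency map the oscillating factor is 1, so this is plain differentiation under the
  -- integral sign. The factors are swapped because the formula integrates over the second variable.
  obtain ⟨L, hL, hm⟩ := hasFDerivAt_oscillatory (ContinuousLinearMap.id ℝ F) (0 : F →L[ℝ] V) Φ' y
  have e : (fun q : F => ∫ v : V, Φ' (ContinuousLinearMap.id ℝ F q, v) *
      Complex.exp (-Complex.I * (inner ℝ v ((0 : F →L[ℝ] V) q) : ℝ))) = Ψ := by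
    funext q
    rw [h]
    simp [Φ']
  rw [e] at hL
  rw [SchwartzMap.lineDerivOp_apply_eq_fderiv, hL.fderiv, hm]
  refine integral_congr_ae (Filter.Eventually.of_forall fun v => ?_)
  have hd : HasFDerivAt Φ' ((fderiv ℝ Φ (v, y)).comp
      (ContinuousLinearEquiv.prodComm ℝ F V : (F × V) →L[ℝ] (V × F))) (y, v) :=
    HasFDerivAt.comp (g := Φ) (y, v) (Φ.differentiableAt (x := (v, y))).hasFDerivAt
      (ContinuousLinearEquiv.prodComm ℝ F V).hasFDerivAt
  simp [hd.fderiv, SchwartzMap.lineDerivOp_apply_eq_fderiv]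

theorem integral_slice_iteratedLineDeriv [FiniteDimensional ℝ F] {n : ℕ} (m : Fin n → F)
    (Φ : 𝓢(V × F, ℂ)) (Ψ : 𝓢(F, ℂ)) (h : ∀ y, Ψ y = ∫ v, Φ (v, y)) (y : F) :
    (∂^{m} Ψ : 𝓢(F, ℂ)) y = ∫ v, (∂^{m} (slice v Φ) : 𝓢(F, ℂ)) y := by
  have hs (w : F) (v : V) (Φ : 𝓢(V × F, ℂ)) :
      (∂_{w} (slice v Φ) : 𝓢(F, ℂ)) = slice v (∂_{((0 : V), w)} Φ) := by
    ext y
    have : HasFDerivAt (slice v Φ) ((fderiv ℝ Φ (v, y)).comp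
        (ContinuousLinearMap.inr ℝ V F)) y :=
      HasFDerivAt.comp (g := Φ) y (Φ.differentiableAt (x := (v, y))).hasFDerivAt
        (hasFDerivAt_prodMk_right v y)
    simp [SchwartzMap.lineDerivOp_apply_eq_fderiv, this.fderiv]
  induction n generalizing Φ Ψ with
  | zero => simpa using h y
  | succ n ih =>
    simp only [LineDeriv.iteratedLineDerivOp_succ_left, ← iteratedLineDeriv_comm, hs]
    exact ih _ _ _ fun y => integral_slice_lineDeriv _ _ _ h y

/-- A closed subspace containing all slices of `Φ` contains their integral. -/
theorem mem_of_forall_slice_mem [FiniteDimensional ℝ F] (W : Submodule ℂ 𝓢(F, ℂ))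
    (hW : IsClosed (W : Set 𝓢(F, ℂ))) (Φ : 𝓢(V × F, ℂ)) (Ψ : 𝓢(F, ℂ))
    (h : ∀ y, Ψ y = ∫ v, Φ (v, y)) (hs : ∀ v, slice v Φ ∈ W) : Ψ ∈ W := by
  by_contra hΨ
  obtain ⟨s, r, hr, hball⟩ := ((schwartz_withSeminorms ℂ F ℂ).mem_nhds_iff Ψ _).1
    (hW.isOpen_compl.mem_nhds hΨ)
  -- A neighbourhood of Ψ avoiding W involves only finitely many seminorms. `J` realises them as the
  -- norm of one Banach space, in which the Bochner integral of the slices makes sense.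
  let J : 𝓢(F, ℂ) →ₗ[ℂ] ((i : s) → BoundedContinuousFunction F (DerivSpace F i.1.2)) :=
    LinearMap.pi fun i => weightedDeriv i.1.1 i.1.2
  have hJc : Continuous J := by
    refine continuous_pi fun i => ?_
    refine WithSeminorms.continuous_normedSpace_rng _ (schwartz_withSeminorms ℂ F ℂ)
      (weightedDeriv i.1.1 i.1.2) ⟨{i.1}, 1, fun f => ?_⟩
    simp [norm_weightedDeriv, schwartzSeminormFamily]
  have hJle (f : 𝓢(F, ℂ)) : s.sup (schwartzSeminormFamily ℂ F ℂ) f ≤ ‖J f‖ := by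
    refine Seminorm.finset_sup_apply_le (norm_nonneg _) fun i hi => ?_
    have := norm_le_pi_norm (J f) ⟨i, hi⟩
    exact (norm_weightedDeriv i.1 i.2 f).symm.le.trans this
  have hcont : Continuous fun v => J (slice v Φ) := hJc.comp (continuous_slice Φ)
  have hint : Integrable fun v => J (slice v Φ) := by
    let q : Seminorm ℂ 𝓢(F, ℂ) := (normSeminorm ℂ _).comp J
    have hq : Continuous q := continuous_norm.comp hJc
    -- A uniform bound together with a bound weighted by a sufficiently high power of ‖v‖ yields
    -- integrability.
    obtain ⟨q₀, -, h₀⟩ := slice_decay (E := V) hq 0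
    obtain ⟨q₁, -, h₁⟩ := slice_decay (E := V) hq (volume : Measure V).integrablePower
    have := integrable_of_le_of_pow_mul_le (μ := (volume : Measure V))
      (f := fun v => J (slice v Φ)) (k := 0) (C₁ := q₀ Φ) (C₂ := q₁ Φ)
      (fun v => by have := h₀ Φ v; rwa [pow_zero, one_mul] at this)
      (fun v => by rw [zero_add]; exact h₁ Φ v) hcont.aestronglyMeasurable
    refine (integrable_norm_iff hcont.aestronglyMeasurable).1 ?_
    simpa using this
  let K : Submodule ℂ ((i : s) → BoundedContinuousFunction F (DerivSpace F i.1.2)) :=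
    (W.map J).topologicalClosure
  have hKmem (v : V) : J (slice v Φ) ∈ K :=
    Submodule.le_topologicalClosure _ (Submodule.mem_map_of_mem (hs v))
  have hmem : ∫ v, J (slice v Φ) ∈ K := by
    -- Since `K` is complete, the integral can be formed inside `K` and then mapped back to the
    -- ambient space.
    have : CompleteSpace K := (Submodule.isClosed_topologicalClosure _).completeSpace_coe
    let g : V → K := fun v => ⟨J (slice v Φ), hKmem v⟩
    have hg : Continuous g := hcont.subtype_mk _
    -- The target need not be separable; strong measurability comes from second countability of V.
    have : SecondCountableTopologyEither V K := secondCountableTopologyEither_of_left V K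
    have hgi : Integrable g := hint.mono hg.aestronglyMeasurable
      (Filter.Eventually.of_forall fun v => le_rfl)
    have := K.subtypeL.integral_comp_comm hgi
    change ∫ v, J (slice v Φ) = _ at this
    rw [this]
    exact (∫ v, g v).2
  have heq : ∫ v, J (slice v Φ) = J Ψ := by
    funext i
    ext1 z
    refine DerivSpace.ext fun m => ?_
    -- Evaluation at a component, a point and a tuple of directions separates points, which reduces
    -- the identity to scalar differentiation under the integral.
    let T : ((i : s) → BoundedContinuousFunction F (DerivSpace F i.1.2)) →L[ℂ] ℂ :=
      (DerivSpace.evalCLM m) ∘L (BoundedContinuousFunction.evalCLM ℂ z) ∘L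
        (ContinuousLinearMap.proj i)
    have hT (f : 𝓢(F, ℂ)) : T (J f) = ((‖z‖ ^ i.1.1 : ℝ) : ℂ) * (∂^{m} f : 𝓢(F, ℂ)) z :=
      evalCLM_weightedIteratedFDeriv _ _ _ _ _
    change T (∫ v, J (slice v Φ)) = T (J Ψ)
    rw [← T.integral_comp_comm hint, hT, integral_slice_iteratedLineDeriv m Φ Ψ h,
      ← integral_const_mul]
    simp only [hT]
  rw [heq] at hmem
  -- J Ψ lies in the closure of J(W), so some w in W is closer than r to Ψ in the chosen seminorms,
  -- contrary to the choice of the ball.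
  obtain ⟨_, hx, hlt⟩ := Metric.mem_closure_iff.1 hmem r hr
  obtain ⟨w, hw, rfl⟩ := hx
  refine hball ?_ hw
  rw [Seminorm.mem_ball]
  refine (hJle _).trans_lt ?_
  rw [map_sub, norm_sub_rev, ← dist_eq_norm]
  exact hlt

end IntegralOfSlices

/-! ### Density of tensor products -/

section Density

theorem hasTemperateGrowth_cexp : (fun t : ℝ => Complex.exp (-Complex.I * t)).HasTemperateGrowth := by
  have hder (n : ℕ) : iteratedDeriv n (fun t : ℝ => Complex.exp (-Complex.I * t)) =
      fun t : ℝ => (-Complex.I) ^ n * Complex.exp (-Complex.I * t) := by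
    induction n with
    | zero => simp
    | succ n ih =>
      rw [iteratedDeriv_succ, ih]
      funext t
      have h : HasDerivAt (fun t : ℝ => -Complex.I * (t : ℂ)) (-Complex.I * 1) t :=
        (Complex.ofRealCLM.hasDerivAt (x := t)).const_mul (-Complex.I)
      rw [(h.cexp.const_mul _).deriv]
      ring
  refine ⟨?_, fun n => ⟨0, 1, fun t => ?_⟩⟩
  · exact Complex.contDiff_exp.comp (contDiff_const.mul Complex.ofRealCLM.contDiff)
  · rw [norm_iteratedFDeriv_eq_norm_iteratedDeriv, hder, norm_mul, norm_exp_neg_I_mul]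
    simp

theorem hasTemperateGrowth_cexp_inner {W V : Type*} [NormedAddCommGroup W] [NormedSpace ℝ W]
    [NormedAddCommGroup V] [InnerProductSpace ℝ V] {f g : W → V} (hf : f.HasTemperateGrowth)
    (hg : g.HasTemperateGrowth) :
    (fun w => Complex.exp (-Complex.I * (inner ℝ (f w) (g w) : ℝ))).HasTemperateGrowth :=
  hasTemperateGrowth_cexp.comp ((innerSL ℝ).bilinear_hasTemperateGrowth hf hg)

@[simp] theorem tensorSchwartz_apply {E F : Type*} [NormedAddCommGroup E] [NormedSpace ℝ E]
    [NormedAddCommGroup F] [NormedSpace ℝ F] (f : 𝓢(E, ℂ)) (g : 𝓢(F, ℂ)) (p : E × F) :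
    tensorSchwartz f g p = f p.1 * g p.2 := rfl

variable {E V : Type*} [NormedAddCommGroup E] [NormedSpace ℝ E] [FiniteDimensional ℝ E]
  [NormedAddCommGroup V] [InnerProductSpace ℝ V] [FiniteDimensional ℝ V]

theorem exists_schwartzMap_eq_one (V : Type*) [NormedAddCommGroup V] [InnerProductSpace ℝ V]
    [FiniteDimensional ℝ V] : ∃ χ : 𝓢(V, ℂ), χ 0 = 1 := by
  let b : ContDiffBump (0 : V) := ⟨1, 2, one_pos, one_lt_two⟩
  have hc : HasCompactSupport fun v => (b v : ℂ) :=
    b.hasCompactSupport.comp_left Complex.ofReal_zero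
  have hs : ContDiff ℝ ∞ fun v => (b v : ℂ) := Complex.ofRealCLM.contDiff.comp b.contDiff
  refine ⟨hc.toSchwartzMap hs, ?_⟩
  change (b 0 : ℂ) = 1
  rw [b.one_of_mem_closedBall (by simp [b])]
  simp

variable [MeasurableSpace V] [BorelSpace V]

/-- Fourier inversion in the second variable: a second forward transform differs from the inverse by
a reflection. Rescaling the frequency by 2π passes to the convention with 2π in the exponent, and
its Jacobian (2π)^dim V cancels the two normalizing constants. -/
theorem partialFourier_partialFourier (c : 𝓢(E × V, ℂ)) (x : E) (y : V) :
    partialFourier (partialFourier c) (x, y) = c (x, -y) := by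
  have hpi : (0 : ℝ) < 2 * Real.pi := by positivity
  set κ : ℝ := (2 * Real.pi) ^ (-(Module.finrank ℝ V : ℝ) / 2) with hκ
  have hκ2 : κ * κ * (2 * Real.pi) ^ (Module.finrank ℝ V) = 1 := by
    rw [hκ, ← Real.rpow_natCast, ← Real.rpow_add hpi, ← Real.rpow_add hpi]
    ring_nf
    simp
  have h1 (η : V) : partialFourier c (x, η) =
      (κ : ℂ) * FourierTransform.fourier (slice x c) ((2 * Real.pi)⁻¹ • η) := by
    rw [← partialFourierIntegral_eq c (x, η)]
    rfl
  rw [partialFourier_apply]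
  simp only [h1]
  have h2 : c (x, -y) = FourierTransformInv.fourierInv
      (FourierTransform.fourier (slice x c)) (-y) := by
    rw [FourierTransform.fourierInv_fourier_eq]
    rfl
  have h3 := Measure.integral_comp_smul (volume : Measure V)
    (fun v => (κ : ℂ) * FourierTransform.fourier (slice x c) v *
      Complex.exp (-Complex.I * (inner ℝ ((2 * Real.pi) • v) y : ℝ))) (2 * Real.pi)⁻¹
  simp only [smul_inv_smul₀ hpi.ne'] at h3
  rw [h3, h2, SchwartzMap.fourierInv_coe, Real.fourierInv_eq, abs_of_pos (by positivity)]
  have h4 : ∫ v : V, (κ : ℂ) * FourierTransform.fourier (slice x c) v *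
      Complex.exp (-Complex.I * (inner ℝ ((2 * Real.pi) • v) y : ℝ)) = κ *
      ∫ v : V, (Real.fourierChar (inner ℝ v (-y))) • FourierTransform.fourier (slice x c) v := by
    rw [← integral_const_mul]
    refine integral_congr_ae (Filter.Eventually.of_forall fun v => ?_)
    simp only [Circle.smul_def, smul_eq_mul, Real.fourierChar_apply, inner_neg_right,
      real_inner_smul_left]
    rw [mul_assoc, mul_comm (Complex.exp _)]
    congr 3
    push_cast
    ring
  rw [h4, inv_pow, inv_inv, ← Complex.coe_smul, smul_eq_mul]
  set Z := ∫ v : V, (Real.fourierChar (inner ℝ v (-y))) • FourierTransform.fourier (slice x c) v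
  have : (κ : ℂ) * κ * (((2 * Real.pi) ^ Module.finrank ℝ V : ℝ) : ℂ) = 1 := by
    exact_mod_cast hκ2
  linear_combination Z * this

theorem partialFourier_surjective :
    Function.Surjective (partialFourier : 𝓢(E × V, ℂ) →L[ℂ] 𝓢(E × V, ℂ)) := by
  intro c
  refine ⟨partialFourier (SchwartzMap.compCLMOfContinuousLinearEquiv ℂ
    ((ContinuousLinearEquiv.refl ℝ E).prodCongr (ContinuousLinearEquiv.neg ℝ)) c), ?_⟩
  ext ⟨x, y⟩
  rw [partialFourier_partialFourier]
  simp

/-- Finite sums of tensor products are dense among Schwartz functions on a product. -/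
theorem topologicalClosure_span_tensorSchwartz :
    (Submodule.span ℂ (Set.range fun p : 𝓢(E, ℂ) × 𝓢(V, ℂ) =>
      tensorSchwartz p.1 p.2)).topologicalClosure = ⊤ := by
  set W := (Submodule.span ℂ (Set.range fun p : 𝓢(E, ℂ) × 𝓢(V, ℂ) =>
      tensorSchwartz p.1 p.2)).topologicalClosure with hW
  have hWc : IsClosed (W : Set 𝓢(E × V, ℂ)) := Submodule.isClosed_topologicalClosure _
  have htensor (f : 𝓢(E, ℂ)) (g : 𝓢(V, ℂ)) : tensorSchwartz f g ∈ W :=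
    Submodule.le_topologicalClosure _ (Submodule.subset_span ⟨(f, g), rfl⟩)
  refine eq_top_iff.2 fun c _ => ?_
  obtain ⟨ĉ, rfl⟩ := partialFourier_surjective c
  set c := partialFourier ĉ with hc
  obtain ⟨χ, hχ⟩ := exists_schwartzMap_eq_one V
  obtain ⟨ρ, hρ⟩ := exists_schwartzMap_eq_one ℝ
  have hgrowth : (fun p : ℝ × (E × V) => χ (p.1 • p.2.2)).HasTemperateGrowth := by
    have h1 : (fun p : ℝ × (E × V) => p.1).HasTemperateGrowth :=
      (ContinuousLinearMap.fst ℝ ℝ (E × V)).hasTemperateGrowth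
    have h2 : (fun p : ℝ × (E × V) => p.2.2).HasTemperateGrowth :=
      ((ContinuousLinearMap.snd ℝ E V).comp (ContinuousLinearMap.snd ℝ ℝ (E × V))).hasTemperateGrowth
    exact χ.hasTemperateGrowth.comp (h1.smul h2)
  -- The cutoff family χ(s y) ρ(s) c(x, y). The factor ρ(s) makes it Schwartz in s as well, so that
  -- s → 0 is covered by `continuous_slice`; since χ(0) = ρ(0) = 1, the slice at s = 0 is c itself.
  let Θ : 𝓢(ℝ × (E × V), ℂ) :=
    SchwartzMap.smulLeftCLM ℂ (fun p : ℝ × (E × V) => χ (p.1 • p.2.2)) (tensorSchwartz ρ c)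
  have hΘ (s : ℝ) (x : E) (y : V) : slice s Θ (x, y) = χ (s • y) * (ρ s * c (x, y)) :=
    SchwartzMap.smulLeftCLM_apply_apply hgrowth _ _
  have hne (s : ℝ) (hs : s ≠ 0) : slice s Θ ∈ W := by
    let χs : 𝓢(V, ℂ) := SchwartzMap.compCLMOfContinuousLinearEquiv ℂ
      (LinearEquiv.smulOfNeZero ℝ V s hs).toContinuousLinearEquiv χ
    have hχs (y : V) : χs y = χ (s • y) := rfl
    let e : (V × (E × V)) ≃L[ℝ] ((E × V) × V) :=
      (ContinuousLinearEquiv.prodAssoc ℝ V E V).symm.trans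
        ((ContinuousLinearEquiv.prodComm ℝ V E).prodCongr (ContinuousLinearEquiv.refl ℝ V))
    have he (η : V) (x : E) (y : V) : e (η, (x, y)) = ((x, η), y) := rfl
    let κ : ℂ := (((2 * Real.pi) ^ (-(Module.finrank ℝ V : ℝ) / 2) : ℝ) : ℂ)
    have hphase : (fun p : V × (E × V) =>
        Complex.exp (-Complex.I * (inner ℝ p.1 p.2.2 : ℝ))).HasTemperateGrowth := by
      refine hasTemperateGrowth_cexp_inner (ContinuousLinearMap.fst ℝ V (E × V)).hasTemperateGrowth
        ((ContinuousLinearMap.snd ℝ E V).comp (ContinuousLinearMap.snd ℝ V (E × V))).hasTemperateGrowth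
    -- The integrand in η after writing c as the partial Fourier transform of ĉ. For fixed η it is a
    -- tensor product in (x, y). The cutoff χ(s y) with s ≠ 0 supplies the decay in y that makes it
    -- jointly Schwartz.
    let Φ : 𝓢(V × (E × V), ℂ) := SchwartzMap.smulLeftCLM ℂ (fun p : V × (E × V) =>
        Complex.exp (-Complex.I * (inner ℝ p.1 p.2.2 : ℝ)))
      (SchwartzMap.compCLMOfContinuousLinearEquiv ℂ e ((ρ s * κ) • tensorSchwartz ĉ χs))
    have hΦ (η : V) (x : E) (y : V) : Φ (η, (x, y)) =
        Complex.exp (-Complex.I * (inner ℝ η y : ℝ)) * ((ρ s * κ) * (ĉ (x, η) * χ (s • y))) :=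
      SchwartzMap.smulLeftCLM_apply_apply hphase _ _
    refine mem_of_forall_slice_mem W hWc Φ (slice s Θ) ?_ fun η => ?_
    · rintro ⟨x, y⟩
      simp only [hΦ]
      rw [hΘ, hc, partialFourier_apply, ← integral_const_mul, ← integral_const_mul,
        ← integral_const_mul]
      refine integral_congr_ae (Filter.Eventually.of_forall fun η => ?_)
      simp only [κ]
      ring
    · have hphase' : (fun y : V => Complex.exp (-Complex.I * (inner ℝ η y : ℝ))).HasTemperateGrowth :=
        hasTemperateGrowth_cexp_inner (Function.HasTemperateGrowth.const η)
          Function.HasTemperateGrowth.id'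
      have : slice η Φ = tensorSchwartz ((ρ s * κ) • slice η
          (SchwartzMap.compCLMOfContinuousLinearEquiv ℂ (ContinuousLinearEquiv.prodComm ℝ V E) ĉ))
          (SchwartzMap.smulLeftCLM ℂ
            (fun y : V => Complex.exp (-Complex.I * (inner ℝ η y : ℝ))) χs) := by
        ext ⟨x, y⟩
        rw [slice_apply, hΦ, tensorSchwartz_apply, SchwartzMap.smulLeftCLM_apply_apply hphase',
          hχs]
        simp
        ring
      rw [this]
      exact htensor _ _
  have hcl : IsClosed {s : ℝ | slice s Θ ∈ W} := hWc.preimage (continuous_slice Θ)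
  have h0 : (0 : ℝ) ∈ {s : ℝ | slice s Θ ∈ W} := by
    -- Membership in W is closed in s and holds for s ≠ 0, hence also at s = 0.
    have hd : closure ({0}ᶜ : Set ℝ) ⊆ {s : ℝ | slice s Θ ∈ W} :=
      closure_minimal (fun s hs => hne s hs) hcl
    exact hd ((dense_compl_singleton (0 : ℝ)) 0)
  have : slice 0 Θ = c := by
    ext ⟨x, y⟩
    rw [hΘ, zero_smul, hχ, hρ]
    ring
  rw [← this]
  exact h0

end Density

/-! ### Joint continuity of the tensor product -/

section TensorContinuity

variable {E F : Type*} [NormedAddCommGroup E] [NormedSpace ℝ E]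
  [NormedAddCommGroup F] [NormedSpace ℝ F]

/-- The bilinear expression in Schwartz seminorms that dominates the seminorm of index `(k, n)` of
a tensor product. -/
noncomputable def tensorBound (k n : ℕ) (f : 𝓢(E, ℂ)) (g : 𝓢(F, ℂ)) : ℝ :=
  ∑ i ∈ Finset.range (n + 1), (n.choose i : ℝ) *
    (SchwartzMap.seminorm ℂ k i f * SchwartzMap.seminorm ℂ 0 (n - i) g +
      SchwartzMap.seminorm ℂ 0 i f * SchwartzMap.seminorm ℂ k (n - i) g)

/-- Leibniz rule together with ‖p‖^k ≤ ‖p.1‖^k + ‖p.2‖^k. Unlike the continuity in g alone that is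
built into `tensorSchwartz`, the bound is explicit in both factors. -/
theorem seminorm_tensorSchwartz_le (k n : ℕ) (f : 𝓢(E, ℂ)) (g : 𝓢(F, ℂ)) :
    SchwartzMap.seminorm ℂ k n (tensorSchwartz f g) ≤ tensorBound k n f g := by
  refine SchwartzMap.seminorm_le_bound ℂ k n _
    (Finset.sum_nonneg fun i _ => by positivity) fun p => ?_
  have hpow : ‖p‖ ^ k ≤ ‖p.1‖ ^ k + ‖p.2‖ ^ k := by
    rcases le_total ‖p.1‖ ‖p.2‖ with h | h
    · rw [Prod.norm_def, max_eq_right h]; simp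
    · rw [Prod.norm_def, max_eq_left h]; simp
  have hf (i : ℕ) : ‖iteratedFDeriv ℝ i (fun p : E × F => f p.1) p‖ ≤
      ‖iteratedFDeriv ℝ i f p.1‖ := by
    have := ContinuousLinearMap.iteratedFDeriv_comp_right (ContinuousLinearMap.fst ℝ E F)
      (f.smooth i) p le_rfl
    change ‖iteratedFDeriv ℝ i (f ∘ ContinuousLinearMap.fst ℝ E F) p‖ ≤ _
    rw [this]
    refine (ContinuousMultilinearMap.norm_compContinuousLinearMap_le _ _).trans ?_
    exact mul_le_of_le_one_right (norm_nonneg _) (Finset.prod_le_one (by simp) fun _ _ =>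
      ContinuousLinearMap.norm_fst_le ℝ E F)
  have hg (i : ℕ) : ‖iteratedFDeriv ℝ i (fun p : E × F => g p.2) p‖ ≤
      ‖iteratedFDeriv ℝ i g p.2‖ := by
    have := ContinuousLinearMap.iteratedFDeriv_comp_right (ContinuousLinearMap.snd ℝ E F)
      (g.smooth i) p le_rfl
    change ‖iteratedFDeriv ℝ i (g ∘ ContinuousLinearMap.snd ℝ E F) p‖ ≤ _
    rw [this]
    refine (ContinuousMultilinearMap.norm_compContinuousLinearMap_le _ _).trans ?_
    exact mul_le_of_le_one_right (norm_nonneg _) (Finset.prod_le_one (by simp) fun _ _ =>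
      ContinuousLinearMap.norm_snd_le ℝ E F)
  have hmul := norm_iteratedFDeriv_mul_le (𝕜 := ℝ) (N := ∞) (n := n)
    (f.smooth'.comp (contDiff_fst (E := E) (F := F)))
    (g.smooth'.comp (contDiff_snd (E := E) (F := F))) p (mod_cast le_top)
  calc
    _ ≤ (‖p.1‖ ^ k + ‖p.2‖ ^ k) * ∑ i ∈ Finset.range (n + 1), (n.choose i : ℝ) *
        ‖iteratedFDeriv ℝ i f p.1‖ * ‖iteratedFDeriv ℝ (n - i) g p.2‖ := by
      gcongr
      refine hmul.trans ?_
      gcongr with i _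
      · exact hf i
      · exact hg (n - i)
    _ = ∑ i ∈ Finset.range (n + 1), (n.choose i : ℝ) *
        ((‖p.1‖ ^ k * ‖iteratedFDeriv ℝ i f p.1‖) *
            (‖p.2‖ ^ 0 * ‖iteratedFDeriv ℝ (n - i) g p.2‖) +
          (‖p.1‖ ^ 0 * ‖iteratedFDeriv ℝ i f p.1‖) *
            (‖p.2‖ ^ k * ‖iteratedFDeriv ℝ (n - i) g p.2‖)) := by
      rw [Finset.mul_sum]
      exact Finset.sum_congr rfl fun i _ => by ring
    _ ≤ tensorBound k n f g := by
      unfold tensorBound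
      gcongr with i _
      · exact SchwartzMap.le_seminorm ℂ k i f p.1
      · exact SchwartzMap.le_seminorm ℂ 0 (n - i) g p.2
      · exact SchwartzMap.le_seminorm ℂ 0 i f p.1
      · exact SchwartzMap.le_seminorm ℂ k (n - i) g p.2

/-- Joint continuity is needed because c ↦ W(c, c) involves c in both factors. The difference at (f,
g) and (f₀, g₀) splits bilinearly into three tensor products, each with a factor f − f₀ or g − g₀.
-/
theorem continuous_tensorSchwartz :
    Continuous fun p : 𝓢(E, ℂ) × 𝓢(F, ℂ) => tensorSchwartz p.1 p.2 := by
  have hcE (k n : ℕ) : Continuous (SchwartzMap.seminorm ℂ k n : 𝓢(E, ℂ) → ℝ) :=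
    (schwartz_withSeminorms ℂ E ℂ).continuous_seminorm (k, n)
  have hcF (k n : ℕ) : Continuous (SchwartzMap.seminorm ℂ k n : 𝓢(F, ℂ) → ℝ) :=
    (schwartz_withSeminorms ℂ F ℂ).continuous_seminorm (k, n)
  refine continuous_iff_continuousAt.2 fun ⟨f₀, g₀⟩ => ?_
  rw [ContinuousAt, (schwartz_withSeminorms ℂ (E × F) ℂ).tendsto_nhds]
  rintro ⟨k, n⟩ ε hε
  let R : 𝓢(E, ℂ) × 𝓢(F, ℂ) → ℝ := fun p => tensorBound k n (p.1 - f₀) (p.2 - g₀) +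
    tensorBound k n (p.1 - f₀) g₀ + tensorBound k n f₀ (p.2 - g₀)
  have hR : Continuous R := by
    unfold R tensorBound
    fun_prop
  have hR0 : R (f₀, g₀) = 0 := by simp [R, tensorBound]
  have := hR.tendsto (f₀, g₀)
  rw [hR0] at this
  filter_upwards [this.eventually_lt_const hε] with p hp
  refine lt_of_le_of_lt ?_ hp
  have hsplit : tensorSchwartz p.1 p.2 - tensorSchwartz f₀ g₀ =
      tensorSchwartz (p.1 - f₀) (p.2 - g₀) + tensorSchwartz (p.1 - f₀) g₀ +
        tensorSchwartz f₀ (p.2 - g₀) := by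
    ext q
    simp only [tensorSchwartz_apply, sub_apply, add_apply]
    ring
  change SchwartzMap.seminorm ℂ k n _ ≤ _
  rw [hsplit]
  refine (map_add_le_add _ _ _).trans (add_le_add ((map_add_le_add _ _ _).trans
    (add_le_add ?_ ?_)) ?_) <;> exact seminorm_tensorSchwartz_le _ _ _ _

end TensorContinuity

/-! ### Parseval's formula and a change of variables -/

section WignerOfWigner

variable {E : Type*} [NormedAddCommGroup E] [InnerProductSpace ℝ E] [FiniteDimensional ℝ E]
  [MeasurableSpace E] [BorelSpace E]

theorem integral_exp_eq_fourier (h : 𝓢(E, ℂ)) (ζ : E) :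
    ∫ s : E, h s * Complex.exp (-Complex.I * (inner ℝ s ζ : ℝ)) =
      FourierTransform.fourier h ((2 * Real.pi)⁻¹ • ζ) := by
  rw [SchwartzMap.fourier_coe, Real.fourier_eq]
  refine integral_congr_ae (Filter.Eventually.of_forall fun y => ?_)
  simp only [Circle.smul_def, smul_eq_mul, Real.fourierChar_apply, inner_smul_right]
  rw [mul_comm]
  congr 2
  push_cast
  have := Real.pi_ne_zero
  field_simp

theorem integral_comp_affine (φ : E → ℂ) (r : ℝ) (hr : 0 < r) (v : E) :
    ∫ y : E, φ (r • y + v) = (((r ^ Module.finrank ℝ E)⁻¹ : ℝ) : ℂ) * ∫ y, φ y := by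
  rw [Measure.integral_comp_smul (volume : Measure E) (fun y => φ (y + v)) r,
    integral_add_right_eq_self φ v, abs_of_pos (by positivity), ← smul_eq_mul, Complex.coe_smul]

/-- Parseval's formula for the product of two reflected Fourier integrals. -/
theorem integral_fourier_mul_fourier_reflected (h k : 𝓢(E, ℂ)) (a b : E) :
    ∫ y : E, (∫ s : E, h s * Complex.exp (-Complex.I * (inner ℝ s (a + (1 / 2 : ℝ) • y) : ℝ))) *
        (∫ t : E, k t * Complex.exp (-Complex.I * (inner ℝ t (a - (1 / 2 : ℝ) • y) : ℝ))) *
        Complex.exp (-Complex.I * (inner ℝ y b : ℝ)) =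
      (((4 * Real.pi) ^ Module.finrank ℝ E : ℝ) : ℂ) *
        ∫ s : E, h s * k (s + (2 : ℝ) • b) *
          Complex.exp (-Complex.I * (inner ℝ ((2 : ℝ) • s + (2 : ℝ) • b) a : ℝ)) := by
  have hpi := Real.pi_ne_zero
  let K : 𝓢(E, ℂ) := FourierTransform.fourier k
  -- The substitution w = y/(4π) + a/(2π) turns the first factor into the Fourier transform of h at
  -- w and the second into `K` at a/π − w. The phase becomes that of `G` times the constant
  -- exp(2i⟨b, a⟩).
  let G : E → ℂ := fun w => K (Real.pi⁻¹ • a - w) *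
    Complex.exp (-Complex.I * (inner ℝ w ((4 * Real.pi) • b) : ℝ))
  have hGint : Integrable G := by
    have h1 : Integrable fun w : E => K (Real.pi⁻¹ • a - w) := K.integrable.comp_sub_left _
    refine h1.mul_bdd (c := 1) (by fun_prop) (Filter.Eventually.of_forall fun y => ?_)
    exact (norm_exp_neg_I_mul _).le
  -- After w ↦ a/π − w the transform of `G` is a Fourier inversion integral for `K` at s + 2b, so k
  -- itself reappears.
  have hFG (s : E) : FourierTransform.fourier G s =
      Complex.exp (-Complex.I * (inner ℝ ((2 : ℝ) • s + (4 : ℝ) • b) a : ℝ)) *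
        k (s + (2 : ℝ) • b) := by
    have hk : k (s + (2 : ℝ) • b) = FourierTransformInv.fourierInv K (s + (2 : ℝ) • b) := by
      rw [FourierTransform.fourierInv_fourier_eq]
    rw [hk, SchwartzMap.fourierInv_coe, Real.fourierInv_eq, Real.fourier_eq,
      ← integral_sub_left_eq_self _ volume (Real.pi⁻¹ • a), ← integral_const_mul]
    refine integral_congr_ae (Filter.Eventually.of_forall fun v => ?_)
    simp only [G, Circle.smul_def, smul_eq_mul, Real.fourierChar_apply, sub_sub_cancel]
    rw [mul_comm (K v), ← mul_assoc, ← mul_assoc, ← Complex.exp_add, ← Complex.exp_add]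
    congr 2
    simp only [inner_sub_left, inner_add_right, real_inner_smul_left,
      real_inner_smul_right, real_inner_comm a]
    push_cast
    have : (Real.pi : ℂ) ≠ 0 := by exact_mod_cast hpi
    field_simp
    ring
  have hpars : ∫ w, FourierTransform.fourier h w * G w =
      ∫ s, h s * FourierTransform.fourier G s := by
    simpa using! VectorFourier.integral_bilin_fourierIntegral_eq_flip (.mul ℂ ℂ) (L := innerₗ E)
      Real.continuous_fourierChar continuous_inner h.integrable hGint
  simp only [integral_exp_eq_fourier]
  have hsub := integral_comp_affine (fun w => FourierTransform.fourier h w * G w)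
    (4 * Real.pi)⁻¹ (by positivity) ((2 * Real.pi)⁻¹ • a)
  rw [hpars] at hsub
  have hlhs : ∫ y : E, FourierTransform.fourier h ((2 * Real.pi)⁻¹ • (a + (1 / 2 : ℝ) • y)) *
      FourierTransform.fourier k ((2 * Real.pi)⁻¹ • (a - (1 / 2 : ℝ) • y)) *
        Complex.exp (-Complex.I * (inner ℝ y b : ℝ)) =
      Complex.exp (Complex.I * (inner ℝ ((2 : ℝ) • b) a : ℝ)) *
      ∫ y : E, (fun w => FourierTransform.fourier h w * G w)
        ((4 * Real.pi)⁻¹ • y + (2 * Real.pi)⁻¹ • a) := by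
    rw [← integral_const_mul]
    refine integral_congr_ae (Filter.Eventually.of_forall fun y => ?_)
    have e1 : (2 * Real.pi)⁻¹ • (a + (1 / 2 : ℝ) • y) =
        (4 * Real.pi)⁻¹ • y + (2 * Real.pi)⁻¹ • a := by
      match_scalars <;> field_simp
      norm_num
    have e2 : (2 * Real.pi)⁻¹ • (a - (1 / 2 : ℝ) • y) =
        Real.pi⁻¹ • a - ((4 * Real.pi)⁻¹ • y + (2 * Real.pi)⁻¹ • a) := by
      match_scalars <;> field_simp <;> norm_num
    simp only [G, K, e1, e2]
    have e3 : Complex.exp (-Complex.I * (inner ℝ y b : ℝ)) =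
        Complex.exp (Complex.I * (inner ℝ ((2 : ℝ) • b) a : ℝ)) *
        Complex.exp (-Complex.I * (inner ℝ ((4 * Real.pi)⁻¹ • y + (2 * Real.pi)⁻¹ • a)
          ((4 * Real.pi) • b) : ℝ)) := by
      rw [← Complex.exp_add]
      congr 1
      simp only [inner_add_left, real_inner_smul_left, real_inner_smul_right, real_inner_comm a]
      push_cast
      have : (Real.pi : ℂ) ≠ 0 := by exact_mod_cast hpi
      field_simp
      ring
    rw [e3]
    ring
  rw [hlhs, hsub, inv_pow, inv_inv, mul_left_comm, ← integral_const_mul]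
  congr 1
  refine integral_congr_ae (Filter.Eventually.of_forall fun s => ?_)
  simp only [hFG]
  have e4 : Complex.exp (-Complex.I * (inner ℝ ((2 : ℝ) • s + (2 : ℝ) • b) a : ℝ)) =
      Complex.exp (Complex.I * (inner ℝ ((2 : ℝ) • b) a : ℝ)) *
      Complex.exp (-Complex.I * (inner ℝ ((2 : ℝ) • s + (4 : ℝ) • b) a : ℝ)) := by
    rw [← Complex.exp_add]
    congr 1
    simp only [inner_add_left, real_inner_smul_left]
    push_cast
    ring
  rw [e4]
  ring

/-- The change of variables `P = y + s + ξ`, `Q = s + ξ - y`. -/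
theorem integral_integral_rotate (m : 𝓢(E × E, ℂ)) (ξ : E) :
    ∫ P : E, ∫ Q : E, m (P, Q) = (((2 : ℝ) ^ Module.finrank ℝ E : ℝ) : ℂ) *
      ∫ y : E, ∫ s : E, m (y + s + ξ, s + ξ - y) := by
  -- Translating s removes ξ; after Fubini the remaining dilation of y by 2 accounts for the factor
  -- 2^dim E.
  have h1 (y : E) : ∫ s : E, m (y + s + ξ, s + ξ - y) = ∫ s : E, m (s + (2 : ℝ) • y, s) := by
    rw [← integral_add_right_eq_self (fun s : E => m (s + (2 : ℝ) • y, s)) (ξ - y)]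
    refine integral_congr_ae (Filter.Eventually.of_forall fun s => ?_)
    change m _ = m _
    congr 2 <;> module
  let e : (E × E) ≃L[ℝ] (E × E) := LinearEquiv.toContinuousLinearEquiv
    { toFun := fun p => (p.2 + (2 : ℝ) • p.1, p.2)
      invFun := fun p => ((1 / 2 : ℝ) • (p.1 - p.2), p.2)
      map_add' := fun p q => by ext <;> simp; module
      map_smul' := fun c p => by ext <;> simp; module
      left_inv := fun p => by ext <;> simp
      right_inv := fun p => by ext <;> simp }
  have hint : Integrable (fun p : E × E => m (p.2 + (2 : ℝ) • p.1, p.2))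
      ((volume : Measure E).prod volume) :=
    (SchwartzMap.compCLMOfContinuousLinearEquiv ℂ e m).integrable
  have hint' : Integrable (fun p : E × E => m (p.1, p.2)) ((volume : Measure E).prod volume) :=
    m.integrable
  have h2 (s : E) : ∫ y : E, m (s + (2 : ℝ) • y, s) =
      ((((2 : ℝ) ^ Module.finrank ℝ E)⁻¹ : ℝ) : ℂ) * ∫ P : E, m (P, s) := by
    rw [← integral_comp_affine (fun P => m (P, s)) 2 two_pos s]
    refine integral_congr_ae (Filter.Eventually.of_forall fun y => ?_)
    change m _ = m _
    rw [add_comm]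
  simp only [h1]
  rw [integral_integral_swap (f := fun y s => m (s + (2 : ℝ) • y, s)) hint]
  simp only [h2]
  rw [integral_const_mul, ← mul_assoc, ← Complex.ofReal_mul, mul_inv_cancel₀ (by positivity),
    Complex.ofReal_one, one_mul, integral_integral_swap (f := fun P Q => m (P, Q)) hint']

end WignerOfWigner

/-! ### The Wigner distribution of Wigner distributions -/

section WignerOfWigner

variable {E : Type*} [NormedAddCommGroup E] [InnerProductSpace ℝ E] [FiniteDimensional ℝ E]
  [MeasurableSpace E] [BorelSpace E]

/-- The cross-Wigner distribution as a function on the Euclidean product. -/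
noncomputable def wignerLp (f g : 𝓢(E, ℂ)) : 𝓢(WithLp 2 (E × E), ℂ) :=
  SchwartzMap.compCLMOfContinuousLinearEquiv ℂ (WithLp.prodContinuousLinearEquiv 2 ℝ E E)
    (wigner f g)

theorem wignerLp_apply (f g : 𝓢(E, ℂ)) (p : WithLp 2 (E × E)) :
    wignerLp f g p = wigner f g (p.fst, p.snd) := rfl

/-- The factor `y ↦ f (x + y / 2) * conj (g (x - y / 2))` of the Wigner integrand. -/
noncomputable def wignerFactor (f g : 𝓢(E, ℂ)) (x : E) : 𝓢(E, ℂ) :=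
  slice x (SchwartzMap.compCLMOfContinuousLinearEquiv ℂ (kappa E)
    (tensorSchwartz f (conjSchwartz g)))

omit [MeasurableSpace E] [BorelSpace E] in
theorem wignerFactor_apply (f g : 𝓢(E, ℂ)) (x y : E) : wignerFactor f g x y =
    f (x + (1 / 2 : ℝ) • y) * starRingEnd ℂ (g (x - (1 / 2 : ℝ) • y)) := rfl

theorem wigner_eq_wignerFactor (f g : 𝓢(E, ℂ)) (x ξ : E) :
    wigner f g (x, ξ) = (((2 * Real.pi) ^ (-(Module.finrank ℝ E : ℝ) / 2) : ℝ) : ℂ) *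
      ∫ y : E, wignerFactor f g x y * Complex.exp (-Complex.I * (inner ℝ y ξ : ℝ)) := rfl

theorem conj_wigner_apply (f g : 𝓢(E, ℂ)) (p : E × E) :
    starRingEnd ℂ (wigner f g p) = wigner g f p := by
  rw [← conj_wigner f g]
  rfl

theorem integral_wignerLp (φ : WithLp 2 (E × E) → ℂ) (hφ : Integrable φ) :
    ∫ Y, φ Y = ∫ y₁ : E, ∫ y₂ : E, φ (WithLp.toLp 2 (y₁, y₂)) := by
  have hmp := WithLp.volume_preserving_toLp E E
  have he : MeasurableEmbedding (WithLp.toLp 2 : E × E → WithLp 2 (E × E)) :=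
    (MeasurableEquiv.toLp 2 (E × E)).measurableEmbedding
  rw [← hmp.integral_comp he, Measure.volume_eq_prod, integral_prod]
  exact (hmp.integrable_comp_emb he).2 hφ

/-- The Wigner distribution of Wigner distributions is a product of Wigner distributions in the
doubled variables. -/
theorem wigner_wignerLp (f g f' g' : 𝓢(E, ℂ)) (p : WithLp 2 (E × E) × WithLp 2 (E × E)) :
    wigner (wignerLp f g) (wignerLp f' g') p =
      wigner f f' (doublingEquiv E p).1 * wigner g' g (doublingEquiv E p).2 := by
  obtain ⟨x, ξ⟩ := p
  set κ : ℝ := (2 * Real.pi) ^ (-(Module.finrank ℝ E : ℝ) / 2) with hκ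
  have hpi : (0 : ℝ) < 2 * Real.pi := by positivity
  have hfin : Module.finrank ℝ (WithLp 2 (E × E)) = 2 * Module.finrank ℝ E := by
    rw [(WithLp.linearEquiv 2 ℝ (E × E)).finrank_eq, Module.finrank_prod, two_mul]
  have hκ' : (2 * Real.pi) ^ (-(Module.finrank ℝ (WithLp 2 (E × E)) : ℝ) / 2) = κ * κ := by
    rw [hκ, hfin, ← Real.rpow_add hpi]
    push_cast
    ring_nf
  -- The normalizations of the two inner Wigner distributions and the Parseval constant (4π)^dim E
  -- combine to the Jacobian of `integral_integral_rotate`.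
  have hκ2 : κ * κ * (4 * Real.pi) ^ Module.finrank ℝ E = 2 ^ Module.finrank ℝ E := by
    rw [show 4 * Real.pi = 2 * (2 * Real.pi) by ring, mul_pow, mul_left_comm, hκ,
      ← Real.rpow_natCast (2 * Real.pi), ← Real.rpow_add hpi, ← Real.rpow_add hpi]
    ring_nf
    simp
  rw [doublingEquiv_apply, wigner_eq_wignerFactor, hκ',
    integral_wignerLp _ (integrable_mul_exp _ ξ)]
  set x₁ := x.fst
  set x₂ := x.snd
  set ξ₁ := ξ.fst
  set ξ₂ := ξ.snd
  -- The conjugate of W(f', g') is W(g', f'), so for fixed y₁ the integrand is a product of Fourier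
  -- integrals at x₂ + y₂/2 and x₂ − y₂/2. The reflected Parseval formula applies with a = x₂ and b
  -- = ξ₂.
  have hinner (y₁ : E) : ∫ y₂ : E, wignerFactor (wignerLp f g) (wignerLp f' g') x
      (WithLp.toLp 2 (y₁, y₂)) *
        Complex.exp (-Complex.I * (inner ℝ (WithLp.toLp 2 (y₁, y₂)) ξ : ℝ)) =
      (κ : ℂ) * κ * (((4 * Real.pi) ^ Module.finrank ℝ E : ℝ) : ℂ) *
        ∫ s : E, wignerFactor f g (x₁ + (1 / 2 : ℝ) • y₁) s *
          wignerFactor g' f' (x₁ - (1 / 2 : ℝ) • y₁) (s + (2 : ℝ) • ξ₂) *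
          Complex.exp (-Complex.I * (inner ℝ ((2 : ℝ) • s + (2 : ℝ) • ξ₂) x₂ : ℝ)) *
          Complex.exp (-Complex.I * (inner ℝ y₁ ξ₁ : ℝ)) := by
    rw [integral_mul_const, ← mul_assoc, mul_assoc ((κ : ℂ) * κ),
      ← integral_fourier_mul_fourier_reflected, mul_right_comm, ← integral_const_mul]
    refine integral_congr_ae (Filter.Eventually.of_forall fun y₂ => ?_)
    have hW : wignerFactor (wignerLp f g) (wignerLp f' g') x (WithLp.toLp 2 (y₁, y₂)) =
        wigner f g (x₁ + (1 / 2 : ℝ) • y₁, x₂ + (1 / 2 : ℝ) • y₂) *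
          wigner g' f' (x₁ - (1 / 2 : ℝ) • y₁, x₂ - (1 / 2 : ℝ) • y₂) := by
      rw [wignerFactor_apply, wignerLp_apply, wignerLp_apply, conj_wigner_apply]
      simp [x₁, x₂]
    have hE : Complex.exp (-Complex.I * (inner ℝ (WithLp.toLp 2 (y₁, y₂)) ξ : ℝ)) =
        Complex.exp (-Complex.I * (inner ℝ y₁ ξ₁ : ℝ)) *
          Complex.exp (-Complex.I * (inner ℝ y₂ ξ₂ : ℝ)) := by
      have h : inner ℝ (WithLp.toLp 2 (y₁, y₂)) ξ = inner ℝ y₁ ξ₁ + inner ℝ y₂ ξ₂ :=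
        WithLp.prod_inner_apply _ _
      rw [← Complex.exp_add, h]
      congr 1
      push_cast
      ring
    simp only [hW, hE, wigner_eq_wignerFactor]
    ring
  simp only [hinner]
  have hphase (ζ : E) : (fun y : E =>
      Complex.exp (-Complex.I * (inner ℝ y ζ : ℝ))).HasTemperateGrowth :=
    hasTemperateGrowth_cexp_inner Function.HasTemperateGrowth.id'
      (Function.HasTemperateGrowth.const ζ)
  let m (φ : 𝓢(E, ℂ)) (ζ : E) : 𝓢(E, ℂ) :=
    SchwartzMap.smulLeftCLM ℂ (fun y : E => Complex.exp (-Complex.I * (inner ℝ y ζ : ℝ))) φ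
  have hm (φ : 𝓢(E, ℂ)) (ζ y : E) :
      m φ ζ y = φ y * Complex.exp (-Complex.I * (inner ℝ y ζ : ℝ)) := by
    rw [mul_comm]
    exact SchwartzMap.smulLeftCLM_apply_apply (hphase ζ) _ _
  let M : 𝓢(E × E, ℂ) := tensorSchwartz
    (m (wignerFactor f f' (x₁ - (1 / 2 : ℝ) • ξ₂)) (x₂ + (1 / 2 : ℝ) • ξ₁))
    (m (wignerFactor g' g (x₁ + (1 / 2 : ℝ) • ξ₂)) (x₂ - (1 / 2 : ℝ) • ξ₁))
  have hrhs : wigner f f' (x₁ - (1 / 2 : ℝ) • ξ₂, x₂ + (1 / 2 : ℝ) • ξ₁) *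
      wigner g' g (x₁ + (1 / 2 : ℝ) • ξ₂, x₂ - (1 / 2 : ℝ) • ξ₁) =
      (κ : ℂ) * κ * ∫ P : E, ∫ Q : E, M (P, Q) := by
    simp only [M, tensorSchwartz_apply, hm]
    simp only [integral_const_mul, integral_mul_const]
    rw [wigner_eq_wignerFactor, wigner_eq_wignerFactor]
    ring
  -- In the rotated variables the arguments of the four functions agree on both sides: the pairs (f,
  -- g), (g', f') are regrouped as (f, f'), (g', g), and the phases match by bilinearity of the
  -- inner product.
  have hM (y s : E) : M (y + s + ξ₂, s + ξ₂ - y) =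
      wignerFactor f g (x₁ + (1 / 2 : ℝ) • y) s *
          wignerFactor g' f' (x₁ - (1 / 2 : ℝ) • y) (s + (2 : ℝ) • ξ₂) *
          Complex.exp (-Complex.I * (inner ℝ ((2 : ℝ) • s + (2 : ℝ) • ξ₂) x₂ : ℝ)) *
          Complex.exp (-Complex.I * (inner ℝ y ξ₁ : ℝ)) := by
    simp only [M, tensorSchwartz_apply, hm, wignerFactor_apply]
    have e1 : x₁ - (1 / 2 : ℝ) • ξ₂ + (1 / 2 : ℝ) • (y + s + ξ₂) =
      x₁ + (1 / 2 : ℝ) • y + (1 / 2 : ℝ) • s := by module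
    have e2 : x₁ - (1 / 2 : ℝ) • ξ₂ - (1 / 2 : ℝ) • (y + s + ξ₂) =
      x₁ - (1 / 2 : ℝ) • y - (1 / 2 : ℝ) • (s + (2 : ℝ) • ξ₂) := by module
    have e3 : x₁ + (1 / 2 : ℝ) • ξ₂ + (1 / 2 : ℝ) • (s + ξ₂ - y) =
      x₁ - (1 / 2 : ℝ) • y + (1 / 2 : ℝ) • (s + (2 : ℝ) • ξ₂) := by module
    have e4 : x₁ + (1 / 2 : ℝ) • ξ₂ - (1 / 2 : ℝ) • (s + ξ₂ - y) =
      x₁ + (1 / 2 : ℝ) • y - (1 / 2 : ℝ) • s := by module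
    have e5 : Complex.exp (-Complex.I * (inner ℝ (y + s + ξ₂) (x₂ + (1 / 2 : ℝ) • ξ₁) : ℝ)) *
        Complex.exp (-Complex.I * (inner ℝ (s + ξ₂ - y) (x₂ - (1 / 2 : ℝ) • ξ₁) : ℝ)) =
        Complex.exp (-Complex.I * (inner ℝ ((2 : ℝ) • s + (2 : ℝ) • ξ₂) x₂ : ℝ)) *
          Complex.exp (-Complex.I * (inner ℝ y ξ₁ : ℝ)) := by
      rw [← Complex.exp_add, ← Complex.exp_add]
      congr 1
      simp only [inner_add_left, inner_sub_left, inner_add_right, inner_sub_right,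
        real_inner_smul_left, real_inner_smul_right]
      push_cast
      ring
    rw [e1, e2, e3, e4]
    linear_combination f (x₁ + (1 / 2 : ℝ) • y + (1 / 2 : ℝ) • s) *
      starRingEnd ℂ (f' (x₁ - (1 / 2 : ℝ) • y - (1 / 2 : ℝ) • (s + (2 : ℝ) • ξ₂))) *
      g' (x₁ - (1 / 2 : ℝ) • y + (1 / 2 : ℝ) • (s + (2 : ℝ) • ξ₂)) *
      starRingEnd ℂ (g (x₁ + (1 / 2 : ℝ) • y - (1 / 2 : ℝ) • s)) * e5
  rw [hrhs, integral_integral_rotate M ξ₂, integral_const_mul, ← hκ2]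
  simp only [hM]
  push_cast
  ring

end WignerOfWigner

/-! ### Positive sesquilinear forms and the Schur product theorem -/

section Sesquilinear

open scoped ComplexOrder Matrix

variable {X : Type*} [AddCommGroup X] [Module ℂ X]

/-- Polarization: the values of the form at f + g and f + ig are real, which fixes the imaginary and
the real parts respectively. -/
theorem sesquilinear_conj_symm (B : X →ₗ[ℂ] X →ₗ⋆[ℂ] ℂ) (hB : ∀ f, 0 ≤ B f f) (f g : X) :
    starRingEnd ℂ (B g f) = B f g := by
  have him (h : X) : (B h h).im = 0 := (Complex.nonneg_iff.1 (hB h)).2.symm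
  have h1 := him (f + g)
  have h2 := him (f + Complex.I • g)
  have hf := him f
  have hg := him g
  simp only [map_add, LinearMap.add_apply, map_smul, LinearMap.smul_apply, map_smulₛₗ,
    Complex.conj_I, smul_eq_mul, Complex.add_im, Complex.mul_im, Complex.I_re, Complex.I_im,
    Complex.neg_re, Complex.neg_im, Complex.mul_re, Complex.add_re] at h1 h2
  apply Complex.ext
  · rw [Complex.conj_re]
    linarith
  · rw [Complex.conj_im]
    linarith

theorem posSemidef_of_sesquilinear (B : X →ₗ[ℂ] X →ₗ⋆[ℂ] ℂ) (hB : ∀ f, 0 ≤ B f f) {ι : Type*}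
    [Fintype ι] (f : ι → X) : (Matrix.of fun i j => B (f i) (f j)).PosSemidef := by
  refine Matrix.PosSemidef.of_dotProduct_mulVec_nonneg ?_ fun x => ?_
  · ext i j
    exact sesquilinear_conj_symm B hB (f i) (f j)
  -- The coefficients are conjugated because B is linear in its first argument, whereas the matrix
  -- quadratic form conjugates the vector on the row index.
  · have h := hB (∑ i, starRingEnd ℂ (x i) • f i)
    convert h using 1
    simp only [dotProduct, Matrix.mulVec, Matrix.of_apply, map_sum, LinearMap.sum_apply, map_smul,
      LinearMap.smul_apply, map_smulₛₗ, Complex.conj_conj, smul_eq_mul, Pi.star_apply,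
      RCLike.star_def, Finset.mul_sum]
    rw [Finset.sum_comm]
    refine Finset.sum_congr rfl fun j _ => Finset.sum_congr rfl fun i _ => ?_
    ring

/-- Schur product theorem for the Gram matrix of f and the transposed Gram matrix of g, with the
quadratic form evaluated at the all-ones vector. -/
theorem sum_sum_mul_nonneg (B : X →ₗ[ℂ] X →ₗ⋆[ℂ] ℂ) (hB : ∀ f, 0 ≤ B f f) {ι : Type*}
    [Fintype ι] (f g : ι → X) : 0 ≤ ∑ i, ∑ j, B (f i) (f j) * B (g j) (g i) := by
  have h := ((posSemidef_of_sesquilinear B hB f).hadamard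
    (posSemidef_of_sesquilinear B hB g).transpose).dotProduct_mulVec_nonneg (fun _ => 1)
  simpa [dotProduct, Matrix.mulVec, Matrix.hadamard] using h

end Sesquilinear

/-! ### Density of Wigner sums and positivity of the doubled symbol -/

section Positivity

variable {V : Type*} [NormedAddCommGroup V] [InnerProductSpace ℝ V] [FiniteDimensional ℝ V]
  [MeasurableSpace V] [BorelSpace V]

theorem wigner_eq (f g : 𝓢(V, ℂ)) : wigner f g = partialFourier
    (SchwartzMap.compCLMOfContinuousLinearEquiv ℂ (kappa V) (tensorSchwartz f (conjSchwartz g))) :=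
  rfl

theorem conjSchwartz_apply {E : Type*} [NormedAddCommGroup E] [NormedSpace ℝ E] (f : 𝓢(E, ℂ))
    (x : E) : conjSchwartz f x = starRingEnd ℂ (f x) := rfl

theorem conjSchwartz_conjSchwartz {E : Type*} [NormedAddCommGroup E] [NormedSpace ℝ E]
    (f : 𝓢(E, ℂ)) : conjSchwartz (conjSchwartz f) = f := by
  ext x
  simp [conjSchwartz_apply]

/-- The cross-Wigner distribution as a sesquilinear map. -/
noncomputable def wignerSesq : 𝓢(V, ℂ) →ₗ[ℂ] 𝓢(V, ℂ) →ₗ⋆[ℂ] 𝓢(V × V, ℂ) :=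
  LinearMap.mk₂'ₛₗ (RingHom.id ℂ) (starRingEnd ℂ) wigner
    (fun f f' g => by
      simp only [wigner_eq, ← map_add]
      congr 2
      ext p
      simp only [tensorSchwartz_apply, add_apply]
      ring)
    (fun c f g => by
      simp only [wigner_eq, ← map_smul, RingHom.id_apply]
      congr 2
      ext p
      simp only [tensorSchwartz_apply, smul_apply, smul_eq_mul]
      ring)
    (fun f g g' => by
      simp only [wigner_eq, ← map_add]
      congr 3
      ext p
      simp only [conjSchwartz_apply, add_apply, map_add])
    (fun c f g => by
      simp only [wigner_eq, ← map_smul]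
      congr 3
      ext p
      simp only [conjSchwartz_apply, smul_apply, smul_eq_mul, map_mul])

theorem wignerSesq_apply (f g : 𝓢(V, ℂ)) : wignerSesq f g = wigner f g := rfl

theorem continuous_wigner_self : Continuous fun f : 𝓢(V, ℂ) => wigner f f := by
  simp only [wigner_eq]
  refine partialFourier.continuous.comp ((ContinuousLinearMap.continuous _).comp ?_)
  have hc : Continuous (conjSchwartz : 𝓢(V, ℂ) → 𝓢(V, ℂ)) := ContinuousLinearMap.continuous
    (SchwartzMap.postcompCLM (𝕜 := ℝ) (Complex.conjCLE : ℂ →L[ℝ] ℂ))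
  exact continuous_tensorSchwartz.comp (continuous_id.prodMk hc)

-- W(f, f) is real, so the conjugation in `pairing` has no effect, and the normalizing constant is
-- positive.
open scoped ComplexOrder in
theorem isNonnegOp_weylOp_iff (σ : 𝓢'(V × V, ℂ)) :
    IsNonnegOp (weylOp σ) ↔ ∀ f : 𝓢(V, ℂ), 0 ≤ σ (wigner f f) := by
  refine forall_congr' fun f => ?_
  rw [pairing_weylOp, pairing, conj_wigner]
  have h : 0 < (2 * Real.pi) ^ (-(Module.finrank ℝ V : ℝ) / 2) := by positivity
  rw [Complex.nonneg_iff, Complex.nonneg_iff, Complex.re_ofReal_mul, Complex.im_ofReal_mul,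
    mul_nonneg_iff_of_pos_left h, zero_eq_mul, or_iff_right h.ne', eq_comm]

/-- Finite sums of cross-Wigner distributions are dense. -/
theorem dense_sum_wignerLp : Dense {c : 𝓢(WithLp 2 (V × V), ℂ) |
    ∃ (n : ℕ) (f g : Fin n → 𝓢(V, ℂ)), c = ∑ i, wignerLp (f i) (g i)} := by
  -- `T` sends the tensor product of f with the conjugate of g to `wignerLp f g`. Being continuous
  -- and surjective, it carries the dense span of tensor products to a dense set.
  let T : 𝓢(V × V, ℂ) →L[ℂ] 𝓢(WithLp 2 (V × V), ℂ) :=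
    SchwartzMap.compCLMOfContinuousLinearEquiv ℂ (WithLp.prodContinuousLinearEquiv 2 ℝ V V) ∘L
      partialFourier ∘L SchwartzMap.compCLMOfContinuousLinearEquiv ℂ (kappa V)
  have hsurj {D E : Type _} [NormedAddCommGroup D] [NormedSpace ℝ D] [NormedAddCommGroup E]
      [NormedSpace ℝ E] (e : D ≃L[ℝ] E) : Function.Surjective
        (SchwartzMap.compCLMOfContinuousLinearEquiv ℂ e : 𝓢(E, ℂ) →L[ℂ] 𝓢(D, ℂ)) := fun φ =>
    ⟨SchwartzMap.compCLMOfContinuousLinearEquiv ℂ e.symm φ, by ext; simp⟩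
  have hT : Function.Surjective T :=
    (hsurj _).comp (partialFourier_surjective.comp (hsurj (kappa V)))
  have hd : Dense ((Submodule.span ℂ (Set.range fun p : 𝓢(V, ℂ) × 𝓢(V, ℂ) =>
      tensorSchwartz p.1 p.2) : Submodule ℂ 𝓢(V × V, ℂ)) : Set 𝓢(V × V, ℂ)) :=
    Submodule.dense_iff_topologicalClosure_eq_top.2 topologicalClosure_span_tensorSchwartz
  refine (hT.denseRange.dense_image T.continuous hd).mono ?_
  rintro _ ⟨Φ, hΦ, rfl⟩
  obtain ⟨n, z, p, rfl⟩ := Submodule.mem_span_set'.1 hΦ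
  choose q hq using fun i => (p i).2
  -- Scalars are absorbed into the first factor; the second is conjugated to offset the conjugation
  -- inside `wigner`.
  refine ⟨n, fun i => z i • (q i).1, fun i => conjSchwartz (q i).2, ?_⟩
  rw [map_sum]
  refine Finset.sum_congr rfl fun i _ => ?_
  have h : z i • (p i : 𝓢(V × V, ℂ)) = tensorSchwartz (z i • (q i).1) (q i).2 := by
    rw [← hq i]
    ext x
    simp only [tensorSchwartz_apply, smul_apply, smul_eq_mul]
    ring
  rw [h, wignerLp, wigner_eq, conjSchwartz_conjSchwartz]
  rfl

/-- The inverse of `doublingEquiv` in the doubled symbol cancels the coordinate change in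
`wigner_wignerLp`, leaving a ⊗ a applied to a tensor product. -/
theorem doubledSymbol_wigner_wignerLp (a : 𝓢'(V × V, ℂ)) (f g f' g' : 𝓢(V, ℂ)) :
    doubledSymbol a (wigner (wignerLp f g) (wignerLp f' g')) =
      a (wigner f f') * a (wigner g' g) := by
  change a (partialEval a (SchwartzMap.compCLMOfContinuousLinearEquiv ℂ (doublingEquiv V).symm
    (wigner (wignerLp f g) (wignerLp f' g')))) = _
  have h : SchwartzMap.compCLMOfContinuousLinearEquiv ℂ (doublingEquiv V).symm
      (wigner (wignerLp f g) (wignerLp f' g')) =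
      tensorSchwartz (wigner f f') (wigner g' g) := by
    ext p
    simp [wigner_wignerLp]
  have h' : partialEval a (tensorSchwartz (wigner f f') (wigner g' g)) =
      a (wigner g' g) • wigner f f' := by
    ext x
    have : slice x (tensorSchwartz (wigner f f') (wigner g' g)) =
        wigner f f' x • wigner g' g := rfl
    rw [partialEval_apply, this, map_smul, smul_apply, smul_eq_mul, smul_eq_mul, mul_comm]
  rw [h, h', map_smul, smul_eq_mul, mul_comm]

open scoped ComplexOrder in
theorem isNonnegOp_weylOp_doubledSymbol (a : 𝓢'(V × V, ℂ)) (ha : IsNonnegOp (weylOp a)) :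
    IsNonnegOp (weylOp (doubledSymbol a)) := by
  rw [isNonnegOp_weylOp_iff] at ha ⊢
  have hcl : IsClosed {c : 𝓢(WithLp 2 (V × V), ℂ) | 0 ≤ doubledSymbol a (wigner c c)} :=
    isClosed_Ici.preimage
      ((ContinuousLinearMap.continuous (doubledSymbol a)).comp continuous_wigner_self)
  intro c
  -- Nonnegativity is a closed condition on c, so finite sums of cross-Wigner distributions suffice.
  refine closure_minimal ?_ hcl (dense_sum_wignerLp c)
  rintro _ ⟨n, f, g, rfl⟩
  let B : 𝓢(V, ℂ) →ₗ[ℂ] 𝓢(V, ℂ) →ₗ⋆[ℂ] ℂ :=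
    wignerSesq.compr₂ₛₗ (show 𝓢(V × V, ℂ) →ₗ[ℂ] ℂ from a.toLinearMap)
  have h := sum_sum_mul_nonneg B ha f g
  rw [Set.mem_ofPred_eq, ← wignerSesq_apply]
  simp only [map_sum, LinearMap.sum_apply, wignerSesq_apply, doubledSymbol_wigner_wignerLp]
  rw [Finset.sum_comm]
  exact h

end Positivity

end WeylCalculus

theorem proposition8p1 (d : ℕ)
    (a : 𝓢'(EuclideanSpace ℝ (Fin d) × EuclideanSpace ℝ (Fin d), ℂ))
    (ha : WeylCalculus.IsNonnegOp (WeylCalculus.weylOp a)) :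
    WeylCalculus.IsNonnegOp (WeylCalculus.weylOp (WeylCalculus.doubledSymbol a)) :=
  WeylCalculus.isNonnegOp_weylOp_doubledSymbol a ha
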